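/- Let $k$ be a field, $Q$ a finite quiver with vertex set $Q_0$ and arrow set $Q_1$, and $I$ a two-sided ideal of the path algebra $kQ$ contained in the span $kQ_{\ge 2}$ of the paths of length at least $2$. Paths are written from right to left, with source $s$ and terminus $t$. Fix an admissible well-order on the set of all paths of $Q$ (a total well-order such that $p<q$ implies $pr<qr$ and $sp<sq$ whenever the products are nonzero, and $p=qr$ implies $p\ge q$ and $p\ge r$). The tip of a nonzero element of $kQ$ is the largest path in its support. Assume that $I$ has a finite reduced Gröbner basis $\mathcal G$. Write $g=\sum_{p\in\mathrm{Supp}(g)}c_g(p)\,p$ for $g\in\mathcal G$. Let $A=kQ/I$, let $\pi:kQ\to A$ be the projection, and let $\mathcal B$ be the set of paths that are not tips of nonzero elements of $I$, identified with the $k$-basis of $A$ formed by their residue classes. For sets of paths $X,Y$ let $k(X/\!/Y)$ be the vector space with basis the pairs $(x,y)\in X\times Y$ with $s(x)=s(y)$ and $t(x)=t(y)$; for $a=\sum_b c_b b\in A$ a combination of elements $b\in\mathcal B$ parallel to $x$, put $(x,a)=\sum_b c_b(x,b)$. For a path $p$ and a pair $(\alpha,\gamma)\in Q_1/\!/\mathcal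 B$, let $p^{(\alpha,\gamma)}\in kQ$ be the sum, over all appearances of the arrow $\alpha$ in $p$, of the paths obtained by replacing that appearance by $\gamma$ (it is $0$ if $\alpha$ does not appear in $p$). Define linear maps $$\psi_0:k(Q_0/\!/\mathcal B)\to k(Q_1/\!/\mathcal B),\quad (e,\gamma)\mapsto\sum_{\alpha\in Q_1,\,s(\alpha)=e}(\alpha,\pi(\alpha\gamma))-\sum_{\beta\in Q_1,\,t(\beta)=e}(\beta,\pi(\gamma\beta)),$$ $$\psi_1:k(Q_1/\!/\mathcal B)\to k(\mathrm{Tip}(\mathcal G)/\!/\mathcal B),\quad (\alpha,\gamma)\mapsto\sum_{g\in\mathcal G}\ \sum_{p\in\mathrm{Supp}(g)}c_g(p)\,(\mathrm{Tip}(g),\pi(p^{(\alpha,\gamma)})).$$ Then $\mathrm{Im}\,\psi_0\subseteq\mathrm{Ker}\,\psi_1$, and the bilinear bracket on $k(Q_1/\!/\mathcal B)$ given by $$[(\alpha,\gamma),(\beta,\varepsilon)]=(\beta,\pi(\varepsilon^{(\alpha,\gamma)}))-(\alpha,\pi(\gamma^{(\beta,\varepsilon)}))$$ maps $\mathrm{Ker}\,\psi_1\times\mathrm{Ker}\,\psi_1$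 to $\mathrm{Ker}\,\psi_1$ and induces a Lie algebra structure on $\mathrm{Ker}\,\psi_1/\mathrm{Im}\,\psi_0$. Moreover, let $\mathrm{HH}^1(A)=\mathrm{Der}_k(A)/\mathrm{Inn}(A)$ be the first Hochschild cohomology, with the Gerstenhaber bracket, which is induced by $[f,g]=f\circ g-g\circ f$. For every $x=\sum c_{(\alpha,\gamma)}(\alpha,\gamma)\in\mathrm{Ker}\,\psi_1$ there is a unique derivation $D_x$ of $A$ that vanishes on the classes of the vertices and sends the class of each arrow $\alpha$ to $\sum_{\gamma}c_{(\alpha,\gamma)}\pi(\gamma)$, and $x\mapsto D_x$ induces an isomorphism of Lie algebras $\mathrm{Ker}\,\psi_1/\mathrm{Im}\,\psi_0\cong\mathrm{HH}^1(A)$. -/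

import Mathlib

noncomputable section

open scoped Classical

/-! ### Paths of a quiver -/

/-- A path of the quiver `V`, with its source vertex `src` and its terminus vertex `tgt`. -/
@[ext] structure QPath (V : Type*) [Quiver V] where
  src : V
  tgt : V
  path : Quiver.Path src tgt

namespace QPath

variable {V : Type*} [Quiver V]

/-- The length of a path. -/
def length (p : QPath V) : ℕ := p.path.length

/-- The trivial path at a vertex. -/
def nil (v : V) : QPath V := ⟨v, v, Quiver.Path.nil⟩

/-- An arrow as a path of length one. -/
def ofArrow {a b : V} (e : a ⟶ b) : QPath V := ⟨a, b, e.toPath⟩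

/-- The path `p q`, with the convention of writing paths from right to left: first `q`,
then `p`. -/
def comp (p q : QPath V) (h : q.tgt = p.src) : QPath V :=
  ⟨q.src, p.tgt, (q.path.cast rfl h).comp p.path⟩

/-- `p` divides `q`: there are paths `u`, `v` with `q = u p v`. -/
def Divides (p q : QPath V) : Prop :=
  ∃ (a b : V) (v : Quiver.Path a p.src) (u : Quiver.Path p.tgt b),
    q = ⟨a, b, (v.comp p.path).comp u⟩

/-- Two paths are parallel if they have the same source and the same terminus. -/
def Parallel (p q : QPath V) : Prop := p.src = q.src ∧ p.tgt = q.tgt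

end QPath

/-- The set `Q_n` of all paths of length `n`. -/
def pathsOfLength (V : Type*) [Quiver V] (n : ℕ) : Set (QPath V) := {p | p.length = n}

/-- A (strict total well-)order on the set of all paths is admissible if it is compatible with
nonzero products on both sides and if every path is at least as large as its factors. -/
structure IsAdmissibleOrder (V : Type*) [Quiver V] [LinearOrder (QPath V)] : Prop where
  wf : WellFounded (fun p q : QPath V => p < q)
  mul_right : ∀ {a b c d : V} (p : Quiver.Path b c) (q : Quiver.Path b d) (r : Quiver.Path a b),
    (⟨b, c, p⟩ : QPath V) < ⟨b, d, q⟩ → (⟨a, c, r.comp p⟩ : QPath V) < ⟨a, d, r.comp q⟩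
  mul_left : ∀ {a b c d : V} (p : Quiver.Path a c) (q : Quiver.Path b c) (s : Quiver.Path c d),
    (⟨a, c, p⟩ : QPath V) < ⟨b, c, q⟩ → (⟨a, d, p.comp s⟩ : QPath V) < ⟨b, d, q.comp s⟩
  factor_left : ∀ {a b c : V} (q : Quiver.Path b c) (r : Quiver.Path a b),
    (⟨b, c, q⟩ : QPath V) ≤ ⟨a, c, r.comp q⟩
  factor_right : ∀ {a b c : V} (q : Quiver.Path b c) (r : Quiver.Path a b),
    (⟨a, b, r⟩ : QPath V) ≤ ⟨a, c, r.comp q⟩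

/-! ### The path algebra -/

/-- The path algebra `kQ`: finite formal linear combinations of paths, multiplied by
concatenation of paths (the product of two paths that do not match is zero). -/
def PathAlgebra (k : Type*) [Field k] (V : Type*) [Quiver V] : Type _ := QPath V →₀ k

namespace PathAlgebra

variable {k : Type*} [Field k] {V : Type*} [Quiver V]

instance : AddCommGroup (PathAlgebra k V) := inferInstanceAs (AddCommGroup (QPath V →₀ k))

instance : Module k (PathAlgebra k V) := inferInstanceAs (Module k (QPath V →₀ k))

/-- An element of the path algebra as a finitely supported function on paths. -/
def coeff : PathAlgebra k V ≃ₗ[k] (QPath V →₀ k) := LinearEquiv.refl k (QPath V →₀ k)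

/-- A path as an element of the path algebra. -/
def of (p : QPath V) : PathAlgebra k V := coeff.symm (Finsupp.single p 1)

/-- The support of an element: the paths occurring in it. -/
def support (f : PathAlgebra k V) : Finset (QPath V) := (coeff f).support

/-- The product of two paths in the path algebra. -/
def pathMul (p q : QPath V) : PathAlgebra k V :=
  if h : q.tgt = p.src then of (p.comp q h) else 0

/-- The multiplication, as the bilinear extension of the product of paths. -/
def mulMap : PathAlgebra k V →ₗ[k] PathAlgebra k V →ₗ[k] PathAlgebra k V :=
  (Finsupp.linearCombination k fun p : QPath V =>
    (Finsupp.linearCombination k fun q : QPath V => (pathMul p q : PathAlgebra k V)) ∘ₗ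
      (coeff : PathAlgebra k V ≃ₗ[k] (QPath V →₀ k)).toLinearMap) ∘ₗ
    (coeff : PathAlgebra k V ≃ₗ[k] (QPath V →₀ k)).toLinearMap

instance : Mul (PathAlgebra k V) := ⟨fun f g => mulMap f g⟩

instance [Fintype V] : One (PathAlgebra k V) := ⟨∑ v : V, of (QPath.nil v)⟩

theorem mul_def (f g : PathAlgebra k V) : f * g = mulMap f g := rfl

theorem one_def [Fintype V] : (1 : PathAlgebra k V) = ∑ v : V, of (QPath.nil v) := rfl

@[simp] theorem coeff_of (p : QPath V) :
    coeff (of p : PathAlgebra k V) = Finsupp.single p 1 := rfl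

theorem of_mul_of (p q : QPath V) : (of p * of q : PathAlgebra k V) = pathMul p q := by
  simp [mul_def, mulMap]

/-- Linear maps out of the path algebra are determined by their values on paths. -/
theorem lhom_ext {M : Type*} [AddCommGroup M] [Module k M] {F G : PathAlgebra k V →ₗ[k] M}
    (h : ∀ p, F (of p) = G (of p)) : F = G :=
  Finsupp.lhom_ext' fun p => LinearMap.ext_ring (h p)

theorem pathMul_assoc (p q r : QPath V) :
    (pathMul p q * of r : PathAlgebra k V) = of p * pathMul q r := by
  obtain ⟨a, b, p⟩ := p
  obtain ⟨c, d, q⟩ := q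
  obtain ⟨e, f, r⟩ := r
  by_cases h1 : d = a
  · subst h1
    by_cases h2 : f = c
    · subst h2
      simp [pathMul, of_mul_of, QPath.comp, Quiver.Path.comp_assoc]
    · have h3 : ∀ s : Quiver.Path c b, (of ⟨c, b, s⟩ * of ⟨e, f, r⟩ : PathAlgebra k V) = 0 := by
        intro s
        rw [of_mul_of]
        exact dif_neg h2
      have h4 : (pathMul ⟨c, d, q⟩ ⟨e, f, r⟩ : PathAlgebra k V) = 0 := dif_neg h2
      rw [h4, mul_def (of _), map_zero, pathMul, dif_pos rfl]
      exact h3 _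
  · have h4 : (pathMul ⟨a, b, p⟩ ⟨c, d, q⟩ : PathAlgebra k V) = 0 := dif_neg h1
    rw [h4, mul_def, map_zero, LinearMap.zero_apply]
    by_cases h2 : f = c
    · subst h2
      have h6 : ∀ s : Quiver.Path e d, (of ⟨a, b, p⟩ * of ⟨e, d, s⟩ : PathAlgebra k V) = 0 := by
        intro s
        rw [of_mul_of]
        exact dif_neg h1
      rw [pathMul, dif_pos rfl]
      exact (h6 _).symm
    · have h5 : (pathMul ⟨c, d, q⟩ ⟨e, f, r⟩ : PathAlgebra k V) = 0 := dif_neg h2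
      rw [h5, mul_def, map_zero]

theorem mul_assoc' (f g h : PathAlgebra k V) : f * g * h = f * (g * h) := by
  have key : (mulMap (k := k) (V := V)).compr₂ mulMap =
      LinearMap.mk₂ k (fun f g : PathAlgebra k V => mulMap f ∘ₗ mulMap g)
        (fun _ _ _ => by rw [map_add, LinearMap.add_comp])
        (fun _ _ _ => by rw [map_smul, LinearMap.smul_comp])
        (fun _ _ _ => by rw [map_add, LinearMap.comp_add])
        (fun _ _ _ => by rw [map_smul, LinearMap.comp_smul]) := by
    refine lhom_ext fun p => lhom_ext fun q => lhom_ext fun r => ?_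
    have := pathMul_assoc (k := k) p q r
    rw [← of_mul_of, ← of_mul_of] at this
    exact this
  exact congrArg (fun F => F f g h) key

theorem one_mul' [Fintype V] (f : PathAlgebra k V) : 1 * f = f := by
  have key : mulMap (1 : PathAlgebra k V) = LinearMap.id := by
    refine lhom_ext fun p => ?_
    rw [one_def, map_sum, LinearMap.sum_apply, Finset.sum_eq_single p.tgt]
    · rw [← mul_def, of_mul_of, pathMul]
      exact dif_pos rfl
    · intro v _ hv
      rw [← mul_def, of_mul_of]
      exact dif_neg fun h => hv h.symm
    · simp
  exact congrArg (fun F => F f) key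

theorem mul_one' [Fintype V] (f : PathAlgebra k V) : f * 1 = f := by
  have key : mulMap.flip (1 : PathAlgebra k V) = LinearMap.id := by
    refine lhom_ext fun p => ?_
    rw [one_def, map_sum, LinearMap.sum_apply, Finset.sum_eq_single p.src]
    · rw [LinearMap.flip_apply, ← mul_def, of_mul_of, pathMul]
      refine (dif_pos rfl).trans ?_
      simp [QPath.comp, QPath.nil]
    · intro v _ hv
      rw [LinearMap.flip_apply, ← mul_def, of_mul_of]
      exact dif_neg hv
    · simp
  exact congrArg (fun F => F f) key

instance [Fintype V] : Ring (PathAlgebra k V) :=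
  { (inferInstance : AddCommGroup (PathAlgebra k V)) with
    mul := (· * ·)
    one := 1
    mul_assoc := mul_assoc'
    one_mul := one_mul'
    mul_one := mul_one'
    left_distrib := fun f g h => map_add (mulMap f) g h
    right_distrib := fun f g h => by
      change mulMap (f + g) h = mulMap f h + mulMap g h
      rw [map_add, LinearMap.add_apply]
    zero_mul := fun f => by
      change mulMap 0 f = 0
      rw [map_zero, LinearMap.zero_apply]
    mul_zero := fun f => map_zero (mulMap f) }

instance [Fintype V] : Algebra k (PathAlgebra k V) :=
  Algebra.ofModule
    (fun c f g => by
      change mulMap (c • f) g = c • mulMap f g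
      rw [map_smul, LinearMap.smul_apply])
    (fun c f g => map_smul (mulMap f) c g)

end PathAlgebra

/-! ### Tips and Groebner bases -/

section Groebner

variable {k : Type*} [Field k] {V : Type*} [Quiver V] [LinearOrder (QPath V)]

/-- The tip of a nonzero element: the largest path in its support. -/
def tip (f : PathAlgebra k V) (hf : f ≠ 0) : QPath V :=
  f.support.max' (Finsupp.support_nonempty_iff.mpr hf)

/-- The set of the tips of the nonzero elements of `W`. -/
def tipSet (W : Set (PathAlgebra k V)) : Set (QPath V) :=
  {p | ∃ f ∈ W, ∃ hf : f ≠ 0, tip f hf = p}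

/-- The paths that are not the tip of an element of `W`. -/
def nonTip (W : Set (PathAlgebra k V)) : Set (QPath V) := (tipSet W)ᶜ

/-- `𝒢` is a reduced Groebner basis of the two-sided ideal `I` (for the given order of paths):
it is contained in `I`, the tips of `𝒢` and of `I` generate the same two-sided ideal, and `𝒢` is
monic, tip-reduced, and has all its non-leading terms in the span of `NonTip(I)`. -/
structure IsReducedGroebnerBasis [Fintype V] (I : Ideal (PathAlgebra k V))
    (𝒢 : Finset (PathAlgebra k V)) : Prop where
  subset : ∀ g ∈ 𝒢, g ∈ I
  span_tip : TwoSidedIdeal.span (PathAlgebra.of '' tipSet (I : Set (PathAlgebra k V))) =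
    TwoSidedIdeal.span (PathAlgebra.of (k := k) '' tipSet (𝒢 : Set (PathAlgebra k V)))
  ne_zero : ∀ g ∈ 𝒢, g ≠ 0
  monic : ∀ (g) (hg : g ∈ 𝒢), PathAlgebra.coeff g (tip g (ne_zero g hg)) = 1
  tip_reduced : ∀ (g) (hg : g ∈ 𝒢) (h) (hh : h ∈ 𝒢), g ≠ h →
    ¬ (tip g (ne_zero g hg)).Divides (tip h (ne_zero h hh))
  tail_mem : ∀ (g) (hg : g ∈ 𝒢), g - PathAlgebra.of (tip g (ne_zero g hg)) ∈
    Submodule.span k (PathAlgebra.of (k := k) '' nonTip (I : Set (PathAlgebra k V)))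

end Groebner

/-! ### The basis `ℬ` of `A = kQ/I` -/

section Basis

variable {k : Type*} [Field k] {V : Type*} [Quiver V] [LinearOrder (QPath V)] [Fintype V]

variable (I : Ideal (PathAlgebra k V)) [I.IsTwoSided]

/-- The canonical projection `π : kQ → A = kQ/I`. -/
abbrev proj : PathAlgebra k V →ₐ[k] PathAlgebra k V ⧸ I := Ideal.Quotient.mkₐ k I

/-- The set of paths `NonTip(I)`, whose residue classes are the basis `ℬ` of `A`. -/
abbrev basisPaths : Set (QPath V) := nonTip (I : Set (PathAlgebra k V))

theorem proj_linearIndependent :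
    LinearIndependent k fun b : basisPaths I => proj I (PathAlgebra.of b.1) := by
  rw [linearIndependent_iff]
  intro l hl
  by_contra hne
  set f : PathAlgebra k V := PathAlgebra.coeff.symm (l.mapDomain Subtype.val) with hf
  have hinj : Function.Injective (Subtype.val : basisPaths I → QPath V) :=
    Subtype.val_injective
  have hfsum : f = l.sum fun b c => c • PathAlgebra.of b.1 := by
    rw [hf, Finsupp.mapDomain, Finsupp.sum, map_sum, Finsupp.sum]
    refine Finset.sum_congr rfl fun b _ => ?_
    rw [PathAlgebra.of, ← map_smul, Finsupp.smul_single, smul_eq_mul, mul_one]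
  have hfI : f ∈ I := by
    rw [← Ideal.Quotient.eq_zero_iff_mem, ← Ideal.Quotient.mkₐ_eq_mk k, hfsum, Finsupp.sum,
      map_sum]
    rw [Finsupp.linearCombination_apply, Finsupp.sum] at hl
    simpa only [map_smul] using hl
  have hf0 : f ≠ 0 := by
    intro h0
    apply hne
    apply Finsupp.mapDomain_injective hinj
    rw [Finsupp.mapDomain_zero]
    exact h0
  have hmem : tip f hf0 ∈ f.support := Finset.max'_mem _ _
  have hmem' : tip f hf0 ∈ (l.mapDomain Subtype.val).support := hmem
  obtain ⟨b, _, hb⟩ := Finset.mem_image.mp (Finsupp.mapDomain_support hmem')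
  exact b.2 ⟨f, hfI, hf0, hb.symm⟩

theorem proj_span (wf : WellFounded fun p q : QPath V => p < q) :
    ⊤ ≤ Submodule.span k (Set.range fun b : basisPaths I => proj I (PathAlgebra.of b.1)) := by
  set S := Submodule.span k (Set.range fun b : basisPaths I => proj I (PathAlgebra.of b.1))
    with hS
  have hsum : ∀ f : PathAlgebra k V, f = ∑ p ∈ f.support, PathAlgebra.coeff f p •
      (PathAlgebra.of p : PathAlgebra k V) := by
    intro f
    apply PathAlgebra.coeff.injective
    rw [map_sum]
    simp only [map_smul, PathAlgebra.coeff_of, Finsupp.smul_single, smul_eq_mul, mul_one]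
    exact (Finsupp.sum_single (PathAlgebra.coeff f)).symm
  have key : ∀ p : QPath V, proj I (PathAlgebra.of p) ∈ S := by
    intro p
    induction p using wf.induction with
    | _ p ih =>
      by_cases hp : p ∈ basisPaths I
      · exact Submodule.subset_span ⟨⟨p, hp⟩, rfl⟩
      · obtain ⟨f, hfI, hf0, hfp⟩ := not_not.mp hp
        have hmem : p ∈ f.support := hfp ▸ Finset.max'_mem _ _
        have hc : PathAlgebra.coeff f p ≠ 0 := Finsupp.mem_support_iff.mp hmem
        have h0 : proj I f = 0 := by
          rw [Ideal.Quotient.mkₐ_eq_mk]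
          exact Ideal.Quotient.eq_zero_iff_mem.mpr hfI
        rw [hsum f, map_sum, ← Finset.add_sum_erase _ _ hmem, map_smul] at h0
        have h1 := eq_neg_of_add_eq_zero_left h0
        have h2 : PathAlgebra.coeff f p • proj I (PathAlgebra.of p) ∈ S := by
          rw [h1]
          refine S.neg_mem (S.sum_mem fun q hq => ?_)
          rw [map_smul]
          refine S.smul_mem _ (ih q ?_)
          have hle : q ≤ p := hfp ▸ Finset.le_max' _ _ (Finset.mem_of_mem_erase hq)
          exact lt_of_le_of_ne hle (Finset.ne_of_mem_erase hq)
        exact (S.smul_mem_iff hc).mp h2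
  intro a _
  obtain ⟨f, rfl⟩ := Ideal.Quotient.mkₐ_surjective k I a
  rw [hsum f, map_sum]
  refine S.sum_mem fun p _ => ?_
  rw [map_smul]
  exact S.smul_mem _ (key p)

/-- The `k`-basis `ℬ` of `A = kQ/I`, consisting of the residue classes of the paths in
`NonTip(I)`. -/
def nonTipBasis (wf : WellFounded fun p q : QPath V => p < q) :
    Module.Basis (basisPaths I) k (PathAlgebra k V ⧸ I) :=
  Module.Basis.mk (proj_linearIndependent I) (proj_span I wf)

end Basis

/-! ### Parallel paths and the maps `ψ₀`, `ψ₁` -/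

section Parallel

/-- The set `X // Y` of parallel pairs of paths. -/
def ParallelPairs {V : Type*} [Quiver V] (X Y : Set (QPath V)) : Type _ :=
  {z : X × Y // z.1.1.Parallel z.2.1}

/-- The vector space `k(X // Y)` with basis the parallel pairs. -/
def PairSpace (k : Type*) [Field k] {V : Type*} [Quiver V] (X Y : Set (QPath V)) : Type _ :=
  ParallelPairs X Y →₀ k

variable {k : Type*} [Field k] {V : Type*} [Quiver V]

namespace PairSpace

variable {X Y : Set (QPath V)}

instance : AddCommGroup (PairSpace k X Y) :=
  inferInstanceAs (AddCommGroup (ParallelPairs X Y →₀ k))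

instance : Module k (PairSpace k X Y) := inferInstanceAs (Module k (ParallelPairs X Y →₀ k))

/-- An element of `k(X // Y)` as a finitely supported function on parallel pairs. -/
def coeff : PairSpace k X Y ≃ₗ[k] (ParallelPairs X Y →₀ k) :=
  LinearEquiv.refl k (ParallelPairs X Y →₀ k)

/-- A parallel pair as an element of `k(X // Y)`. -/
def of (z : ParallelPairs X Y) : PairSpace k X Y := coeff.symm (Finsupp.single z 1)

/-- The linear extension of a map defined on parallel pairs. -/
def extend {M : Type*} [AddCommGroup M] [Module k M] (F : ParallelPairs X Y → M) :
    PairSpace k X Y →ₗ[k] M :=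
  Finsupp.linearCombination k F ∘ₗ
    (coeff : PairSpace k X Y ≃ₗ[k] (ParallelPairs X Y →₀ k)).toLinearMap

end PairSpace

/-- For a path `ε`, the element `ε^(α,γ)` of the path algebra: the sum, over all appearances of
the arrow `α` in `ε`, of the paths obtained by replacing this appearance by `γ`. In the recursion
the path `Path.cons p e` is the product `e p` (first `p`, then the arrow `e`). -/
def replaceAux [Fintype V] (α γ : QPath V) {a : V} :
    ∀ {b : V}, Quiver.Path a b → PathAlgebra k V
  | _, Quiver.Path.nil => 0
  | _, Quiver.Path.cons p e =>
      PathAlgebra.of (QPath.ofArrow e) * replaceAux α γ p +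
        if QPath.ofArrow e = α then PathAlgebra.of γ * PathAlgebra.of ⟨_, _, p⟩ else 0

/-- The element `ε^(α,γ)` of the path algebra, for a path `ε`. -/
def replace [Fintype V] (ε α γ : QPath V) : PathAlgebra k V := replaceAux α γ ε.path

variable [Fintype V] [LinearOrder (QPath V)]
variable (wf : WellFounded fun p q : QPath V => p < q)
variable (I : Ideal (PathAlgebra k V)) [I.IsTwoSided]

/-- For a path `x ∈ X` and `a ∈ A`, the element `(x, a)` of `k(X // ℬ)`: if
`a = ∑ c_b b` in the basis `ℬ`, it is `∑ c_b (x, b)`, where `b` runs through the basis paths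
parallel to `x`. -/
def pairWith {X : Set (QPath V)} (x : X) :
    (PathAlgebra k V ⧸ I) →ₗ[k] PairSpace k X (basisPaths I) :=
  (Finsupp.linearCombination k fun b : basisPaths I =>
    if h : x.1.Parallel b.1 then
      (PairSpace.of ⟨(x, b), h⟩ : PairSpace k X (basisPaths I)) else 0) ∘ₗ
    (nonTipBasis I wf).repr.toLinearMap

/-- An arrow as an element of `Q_1`. -/
def arrow {a b : V} (e : a ⟶ b) : pathsOfLength V 1 := ⟨QPath.ofArrow e, rfl⟩

/-- `ψ₀ : k(Q_0 // ℬ) → k(Q_1 // ℬ)`,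
`(e, γ) ↦ ∑_{α ∈ Q_1 e} (α, π(αγ)) - ∑_{β ∈ e Q_1} (β, π(γβ))`. -/
def psiZero [∀ a b : V, Fintype (a ⟶ b)] :
    PairSpace k (pathsOfLength V 0) (basisPaths I) →ₗ[k]
      PairSpace k (pathsOfLength V 1) (basisPaths I) :=
  PairSpace.extend fun z =>
    (∑ b : V, ∑ α : z.1.1.1.src ⟶ b,
      pairWith wf I (arrow α)
        (proj I (PathAlgebra.of (QPath.ofArrow α) * PathAlgebra.of z.1.2.1))) -
    ∑ a : V, ∑ β : a ⟶ z.1.1.1.src,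
      pairWith wf I (arrow β)
        (proj I (PathAlgebra.of z.1.2.1 * PathAlgebra.of (QPath.ofArrow β)))

/-- The tip of an element of a reduced Groebner basis, as an element of the set of tips. -/
def groebnerTip {I : Ideal (PathAlgebra k V)} {𝒢 : Finset (PathAlgebra k V)}
    (h𝒢 : IsReducedGroebnerBasis I 𝒢) (g : 𝒢) :
    tipSet (𝒢 : Set (PathAlgebra k V)) :=
  ⟨tip g.1 (h𝒢.ne_zero g.1 g.2), g.1, g.2, h𝒢.ne_zero g.1 g.2, rfl⟩

/-- `ψ₁ : k(Q_1 // ℬ) → k(Tip(𝒢) // ℬ)`,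
`(α, γ) ↦ ∑_{g ∈ 𝒢} ∑_{p ∈ Supp(g)} c_g(p) (Tip(g), π(p^(α,γ)))`. -/
def psiOne {𝒢 : Finset (PathAlgebra k V)} (h𝒢 : IsReducedGroebnerBasis I 𝒢) :
    PairSpace k (pathsOfLength V 1) (basisPaths I) →ₗ[k]
      PairSpace k (tipSet (𝒢 : Set (PathAlgebra k V))) (basisPaths I) :=
  PairSpace.extend fun z =>
    ∑ g : 𝒢, ∑ p ∈ g.1.support, PathAlgebra.coeff g.1 p •
      pairWith wf I (groebnerTip h𝒢 g) (proj I (replace p z.1.1.1 z.1.2.1))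

/-- The bilinear bracket on `k(Q_1 // ℬ)` with
`[(α, γ), (β, ε)] = (β, π(ε^(α,γ))) - (α, π(γ^(β,ε)))`. -/
def parallelBracket :
    PairSpace k (pathsOfLength V 1) (basisPaths I) →ₗ[k]
      PairSpace k (pathsOfLength V 1) (basisPaths I) →ₗ[k]
        PairSpace k (pathsOfLength V 1) (basisPaths I) :=
  PairSpace.extend fun z => PairSpace.extend fun w =>
    pairWith wf I w.1.1 (proj I (replace w.1.2.1 z.1.1.1 z.1.2.1)) -
      pairWith wf I z.1.1 (proj I (replace z.1.2.1 w.1.1.1 w.1.2.1))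

/-- The quotient `Ker ψ₁ / Im ψ₀` (literally: of `Ker ψ₁` by `Ker ψ₁ ∩ Im ψ₀`). -/
abbrev KerModIm [∀ a b : V, Fintype (a ⟶ b)] {𝒢 : Finset (PathAlgebra k V)}
    (h𝒢 : IsReducedGroebnerBasis I 𝒢) : Type _ :=
  LinearMap.ker (psiOne wf I h𝒢) ⧸
    (LinearMap.range (psiZero wf I)).submoduleOf (LinearMap.ker (psiOne wf I h𝒢))

variable {I} in
/-- The value at the arrow `α` of the `E`-bimodule map `kQ_1 → A` that corresponds to
`x ∈ k(Q_1 // ℬ)`: the sum of `c π(γ)` over the terms `c (α, γ)` of `x`. -/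
def valueAt (x : PairSpace k (pathsOfLength V 1) (basisPaths I))
    (α : pathsOfLength V 1) : PathAlgebra k V ⧸ I :=
  PairSpace.extend (fun z => if z.1.1 = α then proj I (PathAlgebra.of z.1.2.1) else 0) x

end Parallel

/-- A bilinear map is a Lie bracket if it is alternating and satisfies the Jacobi identity. -/
structure IsLieBracket {k M : Type*} [Field k] [AddCommGroup M] [Module k M]
    (br : M →ₗ[k] M →ₗ[k] M) : Prop where
  self : ∀ u, br u u = 0
  jacobi : ∀ u v w, br u (br v w) + br v (br w u) + br w (br u v) = 0

/-! ### The first Hochschild cohomology with the Gerstenhaber bracket -/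

section Hochschild

variable (k : Type*) [Field k] (A : Type*) [Ring A] [Algebra k A]

/-- The Hochschild differential `δ⁰ : A → Hom_k(A, A)`, `(δ⁰ a)(x) = a x - x a`. -/
def hochschildDeltaZero : A →ₗ[k] (A →ₗ[k] A) := LinearMap.mul k A - (LinearMap.mul k A).flip

/-- The Hochschild differential `δ¹ : Hom_k(A, A) → Hom_k(A ⊗ A, A)` (bilinear maps),
`(δ¹ f)(x, y) = x f(y) - f(x y) + f(x) y`. -/
def hochschildDeltaOne : (A →ₗ[k] A) →ₗ[k] (A →ₗ[k] A →ₗ[k] A) where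
  toFun f := (LinearMap.mul k A).compl₂ f - (LinearMap.mul k A).compr₂ f +
    (LinearMap.mul k A) ∘ₗ f
  map_add' f g := by
    ext x y
    simp [mul_add]
    abel
  map_smul' c f := by
    ext x y
    simp [smul_sub, smul_add]

attribute [local instance] LieRing.ofAssociativeRing LieAlgebra.ofAssociativeAlgebra

theorem mem_ker_hochschildDeltaOne (f : A →ₗ[k] A) :
    f ∈ LinearMap.ker (hochschildDeltaOne k A) ↔ ∀ x y, f (x * y) = x * f y + f x * y := by
  rw [LinearMap.mem_ker]
  constructor
  · intro h x y
    have h1 : x * f y - f (x * y) + f x * y = 0 := congrArg (fun F => F x y) h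
    rw [eq_comm, ← sub_eq_zero, ← h1]
    abel
  · intro h
    ext x y
    change x * f y - f (x * y) + f x * y = 0
    rw [h x y]
    abel

/-- The Hochschild 1-cocycles `Ker δ¹`, with the Gerstenhaber bracket
`[f, g] = f ∘ g - g ∘ f`. -/
def hochschildCocycles : LieSubalgebra k (Module.End k A) where
  __ := LinearMap.ker (hochschildDeltaOne k A)
  lie_mem' := by
    intro f g hf hg
    have hf' := (mem_ker_hochschildDeltaOne k A f).mp hf
    have hg' := (mem_ker_hochschildDeltaOne k A g).mp hg
    refine (mem_ker_hochschildDeltaOne k A _).mpr fun x y => ?_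
    change f (g (x * y)) - g (f (x * y)) =
      x * (f (g y) - g (f y)) + (f (g x) - g (f x)) * y
    rw [hf', hg', map_add, map_add, hf', hf', hg', hg', mul_sub, sub_mul]
    abel

/-- The Hochschild 1-coboundaries `Im δ⁰`, a Lie ideal of the 1-cocycles. -/
def hochschildCoboundaries : LieIdeal k (hochschildCocycles k A) where
  __ := (LinearMap.range (hochschildDeltaZero k A)).comap
    (hochschildCocycles k A).toSubmodule.subtype
  lie_mem := by
    rintro ⟨f, hf⟩ ⟨g, hg⟩ ⟨a, ha⟩
    have hf' := (mem_ker_hochschildDeltaOne k A f).mp hf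
    refine ⟨f a, ?_⟩
    have ha' : ∀ x, g x = a * x - x * a := fun x => (congrArg (fun F => F x) ha).symm
    ext x
    change f a * x - x * f a = f (g x) - g (f x)
    rw [ha', ha', map_sub, hf', hf']
    abel

/-- The first Hochschild cohomology `HH¹(A) = Ker δ¹ / Im δ⁰`. -/
def HochschildOne : Type _ := hochschildCocycles k A ⧸ hochschildCoboundaries k A

/-- The Lie ring structure on `HH¹(A)` given by the Gerstenhaber bracket. -/
instance : LieRing (HochschildOne k A) :=
  inferInstanceAs (LieRing (hochschildCocycles k A ⧸ hochschildCoboundaries k A))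

instance : LieAlgebra k (HochschildOne k A) :=
  inferInstanceAs (LieAlgebra k (hochschildCocycles k A ⧸ hochschildCoboundaries k A))

variable {k A}

/-- The class in `HH¹(A)` of a Hochschild 1-cocycle. -/
def HochschildOne.mk (f : A →ₗ[k] A) (hf : f ∈ LinearMap.ker (hochschildDeltaOne k A)) :
    HochschildOne k A :=
  LieSubmodule.Quotient.mk (N := hochschildCoboundaries k A)
    (⟨f, hf⟩ : hochschildCocycles k A)

/-- The bracket on `HH¹(A)` is induced by `[f, g] = f ∘ g - g ∘ f`. -/
theorem HochschildOne.lie_mk (f g : A →ₗ[k] A) (hf : f ∈ LinearMap.ker (hochschildDeltaOne k A))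
    (hg : g ∈ LinearMap.ker (hochschildDeltaOne k A)) :
    ∃ h : f ∘ₗ g - g ∘ₗ f ∈ LinearMap.ker (hochschildDeltaOne k A),
      ⁅HochschildOne.mk f hf, HochschildOne.mk g hg⁆ = HochschildOne.mk (f ∘ₗ g - g ∘ₗ f) h :=
  ⟨(hochschildCocycles k A).lie_mem hf hg, rfl⟩

end Hochschild

end

/-!
The theorem holds because `k(Q_1 // ℬ)` is the space of derivations `kQ → A` over `π : kQ → A`
that vanish on the vertices. An element `x = ∑ c_(α,γ) (α, γ)` gives the derivation
`δ_x : p ↦ ∑ c_(α,γ) π(p^(α,γ))` (`pairDerivation`). A derivation is determined by its values on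
vertices and arrows (`IsProjDerivation.ext`), its value at an arrow `α` lies in `t(α) A s(α)`, and
the non-tips parallel to `α` are a basis of this space; so `x ↦ δ_x` is a bijection
(`pairDerivation_injective`, `exists_pairDerivation_eq`).

The elements of the reduced Groebner basis are uniform, i.e. all the paths in the support of `g`
are parallel to its tip (`IsReducedGroebnerBasis.corner_eq`), so the `Tip(g)`-component of `ψ₁ x`
is exactly `δ_x(g)` (`component_psiOne`). Division by `𝒢` shows that `𝒢` generates `I`
(`IsReducedGroebnerBasis.le_of_mul_mem`). Hence `Ker ψ₁` consists of the `x` for which `δ_x` kills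
`I` (`mem_ker_psiOne_iff`), that is, for which `δ_x = D_x ∘ π` with a derivation `D_x` of `A`
(`inducedMap`).

The derivation of `ψ₀ w` is the commutator with an element of `A` (`pairDerivation_psiZero`), and
all the elements of `A` that commute with the vertices arise in this way (`exists_loopValue_eq`);
so `Im ψ₀` corresponds to the inner derivations that vanish on the vertices. Every derivation of
`A` vanishes on the vertices after an inner derivation is subtracted
(`exists_inner_eq_on_vertices`). Therefore `x ↦ D_x` induces a bijection of `Ker ψ₁ / Im ψ₀` with
`HH¹(A)`. Comparing values on arrows, `D_[x,y] = D_x D_y - D_y D_x` on `Ker ψ₁`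
(`pairDerivation_parallelBracket`), so the bracket of `k(Q_1 // ℬ)` corresponds to the Gerstenhaber
bracket, from which it inherits the Lie algebra axioms.
-/

noncomputable section

open scoped Classical

/-! ### Products of paths -/

namespace PathAlgebra

variable {k : Type*} [Field k] {V : Type*} [Quiver V]

theorem of_mk_mul_of_mk {a b c : V} (p : Quiver.Path b c) (q : Quiver.Path a b) :
    (of ⟨b, c, p⟩ * of ⟨a, b, q⟩ : PathAlgebra k V) = of ⟨a, c, q.comp p⟩ := by
  rw [of_mul_of, pathMul]
  exact dif_pos rfl

theorem of_mul_of_eq_zero {p q : QPath V} (h : q.tgt ≠ p.src) :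
    (of p * of q : PathAlgebra k V) = 0 := by
  rw [of_mul_of, pathMul, dif_neg h]

theorem of_nil_mul_of (v : V) (p : QPath V) :
    (of (QPath.nil v) * of p : PathAlgebra k V) = if p.tgt = v then of p else 0 := by
  split_ifs with h
  · subst h
    exact of_mk_mul_of_mk _ _
  · exact of_mul_of_eq_zero h

theorem of_mul_of_nil (p : QPath V) (v : V) :
    (of p * of (QPath.nil v) : PathAlgebra k V) = if p.src = v then of p else 0 := by
  split_ifs with h
  · subst h
    refine (of_mk_mul_of_mk _ _).trans ?_
    rw [Quiver.Path.nil_comp]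
  · exact of_mul_of_eq_zero (Ne.symm h)

theorem of_cons {a b c : V} (p : Quiver.Path a b) (e : b ⟶ c) :
    (of ⟨a, c, p.cons e⟩ : PathAlgebra k V) = of (QPath.ofArrow e) * of ⟨a, b, p⟩ :=
  (of_mk_mul_of_mk e.toPath p).symm

theorem eq_sum_support (f : PathAlgebra k V) : f = ∑ p ∈ f.support, coeff f p • of p := by
  apply coeff.injective
  rw [map_sum]
  simp only [map_smul, coeff_of, Finsupp.smul_single, smul_eq_mul, mul_one]
  exact (Finsupp.sum_single (coeff f)).symm

theorem mem_span_of_iff {S : Set (QPath V)} {f : PathAlgebra k V} :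
    f ∈ Submodule.span k (of (k := k) '' S) ↔ ∀ p ∈ f.support, p ∈ S := by
  change f ∈ Submodule.span k ((fun p => Finsupp.single p (1 : k)) '' S) ↔ _
  rw [← Finsupp.supported_eq_span_single]
  exact Finsupp.mem_supported k f

variable [Fintype V]

theorem corner_of (v w : V) (p : QPath V) :
    (of (QPath.nil w) * of p * of (QPath.nil v) : PathAlgebra k V) =
      if p.src = v ∧ p.tgt = w then of p else 0 := by
  rw [of_nil_mul_of]
  by_cases h : p.tgt = w
  · simp only [h, if_true, and_true, of_mul_of_nil]
  · simp [h]

theorem corner_of_parallel (p q : QPath V) :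
    (of (QPath.nil p.tgt) * of q * of (QPath.nil p.src) : PathAlgebra k V) =
      if p.Parallel q then of q else 0 := by
  rw [corner_of]
  exact if_congr (and_congr eq_comm eq_comm) rfl rfl

end PathAlgebra

/-! ### Replacing arrows is a derivation -/

section Replace

open PathAlgebra

variable {k : Type*} [Field k] {V : Type*} [Quiver V] [Fintype V]

theorem of_nil_mul_replaceAux {α γ : QPath V} (h : α.Parallel γ) {a b : V}
    (p : Quiver.Path a b) :
    (of (QPath.nil b) * replaceAux α γ p : PathAlgebra k V) = replaceAux α γ p := by
  cases p with
  | nil => exact mul_zero _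
  | cons p e =>
    rw [replaceAux, mul_add, ← mul_assoc, of_nil_mul_of,
      if_pos (show (QPath.ofArrow e).tgt = b from rfl)]
    congr 1
    split_ifs with he
    · subst he
      rw [← mul_assoc, of_nil_mul_of, if_pos (show γ.tgt = b from h.2.symm)]
    · exact mul_zero _

theorem replaceAux_mul_of_nil {α γ : QPath V} {a b : V} (p : Quiver.Path a b) :
    (replaceAux α γ p * of (QPath.nil a) : PathAlgebra k V) = replaceAux α γ p := by
  induction p with
  | nil => exact zero_mul _
  | cons p e ih =>
    rw [replaceAux, add_mul, mul_assoc, ih]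
    congr 1
    split_ifs with he
    · rw [mul_assoc, of_mul_of_nil, if_pos rfl]
    · exact zero_mul _

theorem replaceAux_comp {α γ : QPath V} (h : α.Parallel γ) {a b c : V} (q : Quiver.Path a b)
    (p : Quiver.Path b c) :
    (replaceAux α γ (q.comp p) : PathAlgebra k V) =
      of ⟨b, c, p⟩ * replaceAux α γ q + replaceAux α γ p * of ⟨a, b, q⟩ := by
  induction p with
  | nil =>
    refine (of_nil_mul_replaceAux h q).symm.trans ?_
    rw [replaceAux, zero_mul, add_zero]
    rfl
  | cons p e ih =>
    rw [Quiver.Path.comp_cons, replaceAux, ih, replaceAux, of_cons, ← of_mk_mul_of_mk p q,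
      mul_add, add_mul]
    split_ifs <;> simp only [mul_assoc, add_assoc, add_zero, zero_mul]

theorem replace_nil (v : V) (α γ : QPath V) :
    (replace (QPath.nil v) α γ : PathAlgebra k V) = 0 := rfl

theorem replace_ofArrow {α γ : QPath V} (h : α.Parallel γ) {a b : V} (e : a ⟶ b) :
    (replace (QPath.ofArrow e) α γ : PathAlgebra k V) =
      if QPath.ofArrow e = α then of γ else 0 := by
  change replaceAux α γ (Quiver.Path.nil.cons e) = _
  rw [replaceAux, replaceAux, mul_zero, zero_add]
  refine if_ctx_congr Iff.rfl (fun he => ?_) fun _ => rfl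
  subst he
  exact (of_mul_of_nil γ a).trans (if_pos h.1.symm)

/-- The linear endomorphism `p ↦ p^(α,γ)` of the path algebra. -/
def replaceLin (k : Type*) [Field k] (α γ : QPath V) : PathAlgebra k V →ₗ[k] PathAlgebra k V :=
  (Finsupp.linearCombination k fun p : QPath V => (replace p α γ : PathAlgebra k V)) ∘ₗ
    (coeff : PathAlgebra k V ≃ₗ[k] (QPath V →₀ k)).toLinearMap

theorem replaceLin_of (p α γ : QPath V) :
    replaceLin k α γ (of p) = (replace p α γ : PathAlgebra k V) := by
  simp [replaceLin]

theorem replaceLin_mul {α γ : QPath V} (h : α.Parallel γ) (f g : PathAlgebra k V) :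
    replaceLin k α γ (f * g) = f * replaceLin k α γ g + replaceLin k α γ f * g := by
  have key : (LinearMap.mul k (PathAlgebra k V)).compr₂ (replaceLin k α γ) =
      (LinearMap.mul k (PathAlgebra k V)).compl₂ (replaceLin k α γ) +
        LinearMap.mul k (PathAlgebra k V) ∘ₗ replaceLin k α γ := by
    refine lhom_ext fun p => lhom_ext fun q => ?_
    simp only [LinearMap.compr₂_apply, LinearMap.mul_apply', LinearMap.add_apply,
      LinearMap.compl₂_apply, LinearMap.comp_apply, replaceLin_of]
    obtain ⟨b, c, p⟩ := p
    obtain ⟨a, b', q⟩ := q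
    by_cases hb : b' = b
    · subst hb
      rw [of_mk_mul_of_mk, replaceLin_of]
      exact replaceAux_comp h q p
    · have h0 : (of (QPath.nil b) * of (QPath.nil b') : PathAlgebra k V) = 0 :=
        of_mul_of_eq_zero hb
      have h1 : (of ⟨b, c, p⟩ * of (QPath.nil b) : PathAlgebra k V) = of ⟨b, c, p⟩ :=
        (of_mul_of_nil _ _).trans (if_pos rfl)
      have h2 : (of (QPath.nil b') * of ⟨a, b', q⟩ : PathAlgebra k V) = of ⟨a, b', q⟩ :=
        (of_nil_mul_of _ _).trans (if_pos rfl)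
      rw [of_mul_of_eq_zero (by exact hb), map_zero, replace, replace,
        ← of_nil_mul_replaceAux h q, ← replaceAux_mul_of_nil p, ← h1, ← h2, mul_assoc, mul_assoc,
        ← mul_assoc (of (QPath.nil b)), ← mul_assoc (of (QPath.nil b)), h0]
      simp
  exact congrArg (fun F => F f g) key

end Replace

/-! ### Elements of `k(X // ℬ)` as families of elements of `A` -/

section Component

open PathAlgebra

variable {k : Type*} [Field k] {V : Type*} [Quiver V]

namespace PairSpace

variable {X Y : Set (QPath V)} {M : Type*} [AddCommGroup M] [Module k M]

@[simp] theorem extend_of (F : ParallelPairs X Y → M) (z : ParallelPairs X Y) :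
    extend (k := k) F (of z) = F z := by
  simp [extend, of]

theorem lhom_ext {F G : PairSpace k X Y →ₗ[k] M} (h : ∀ z, F (of z) = G (of z)) : F = G :=
  Finsupp.lhom_ext' fun z => LinearMap.ext_ring (h z)

end PairSpace

variable [Fintype V] [LinearOrder (QPath V)]
variable (wf : WellFounded fun p q : QPath V => p < q)
variable (I : Ideal (PathAlgebra k V)) [I.IsTwoSided]

theorem nonTipBasis_apply (b : basisPaths I) : nonTipBasis I wf b = proj I (of b.1) :=
  Module.Basis.mk_apply _ _ b

variable {X : Set (QPath V)}

/-- The `x`-component `∑ c_(x,b) b ∈ A` of an element `∑ c_(y,b) (y, b)` of `k(X // ℬ)`. For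
`X = Q_1` it is `valueAt`. -/
def component (x : X) : PairSpace k X (basisPaths I) →ₗ[k] PathAlgebra k V ⧸ I :=
  PairSpace.extend fun z => if z.1.1 = x then proj I (of z.1.2.1) else 0

theorem component_of (x : X) (z : ParallelPairs X (basisPaths I)) :
    component I x (PairSpace.of z) = if z.1.1 = x then proj I (of z.1.2.1) else 0 :=
  PairSpace.extend_of _ z

theorem pairWith_proj_of (x : X) (b : basisPaths I) :
    pairWith wf I x (proj I (of b.1)) =
      if h : x.1.Parallel b.1 then PairSpace.of ⟨(x, b), h⟩ else 0 := by
  rw [← nonTipBasis_apply wf, pairWith]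
  simp

/-- Dropping the basis paths that are not parallel to `x` amounts to multiplying by the end points
of `x` on both sides. -/
theorem component_pairWith (x y : X) (a : PathAlgebra k V ⧸ I) :
    component I y (pairWith wf I x a) =
      if x = y then proj I (of (QPath.nil x.1.tgt)) * a * proj I (of (QPath.nil x.1.src))
      else 0 := by
  have key : component I y ∘ₗ pairWith wf I x = if x = y then
      LinearMap.mulRight k (proj I (of (QPath.nil x.1.src))) ∘ₗ
        LinearMap.mulLeft k (proj I (of (QPath.nil x.1.tgt))) else 0 := by
    refine (nonTipBasis I wf).ext fun b => ?_
    rw [nonTipBasis_apply, LinearMap.comp_apply, pairWith_proj_of]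
    by_cases hxy : x = y
    · rw [if_pos hxy, LinearMap.comp_apply, LinearMap.mulLeft_apply, LinearMap.mulRight_apply,
        ← map_mul, ← map_mul, corner_of_parallel]
      split_ifs
      · exact (component_of I _ _).trans (if_pos hxy)
      · rw [map_zero, map_zero]
    · rw [if_neg hxy, LinearMap.zero_apply]
      split_ifs
      · exact (component_of I _ _).trans (if_neg hxy)
      · rw [map_zero]
  have h := congrArg (fun F => F a) key
  rw [LinearMap.comp_apply] at h
  rw [h]
  split_ifs <;> rfl

/-- The coefficient of `(x, b)` is the coordinate at `b` of the `x`-component. -/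
theorem coeff_eq_repr_component (u : PairSpace k X (basisPaths I))
    (z : ParallelPairs X (basisPaths I)) :
    PairSpace.coeff u z = (nonTipBasis I wf).repr (component I z.1.1 u) z.1.2 := by
  have key : Finsupp.lapply z ∘ₗ (PairSpace.coeff (k := k)).toLinearMap =
      Finsupp.lapply z.1.2 ∘ₗ (nonTipBasis I wf).repr.toLinearMap ∘ₗ component I z.1.1 := by
    refine PairSpace.lhom_ext fun w => ?_
    change Finsupp.single w (1 : k) z = (nonTipBasis I wf).repr (component I z.1.1 _) z.1.2
    rw [component_of]
    by_cases hwz : w = z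
    · subst hwz
      rw [if_pos rfl, ← nonTipBasis_apply wf, Module.Basis.repr_self, Finsupp.single_eq_same,
        Finsupp.single_eq_same]
    · rw [Finsupp.single_eq_of_ne (Ne.symm hwz)]
      split_ifs with hx
      · rw [← nonTipBasis_apply wf, Module.Basis.repr_self, Finsupp.single_eq_of_ne]
        exact fun h => hwz (Subtype.ext (Prod.ext hx h.symm))
      · rw [map_zero]
        rfl
  exact congrArg (fun F => F u) key

include wf in
theorem component_ext {u v : PairSpace k X (basisPaths I)}
    (h : ∀ x, component I x u = component I x v) : u = v := by
  apply PairSpace.coeff.injective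
  ext z
  rw [coeff_eq_repr_component wf, coeff_eq_repr_component wf, h]

end Component

/-! ### Derivations `kQ → A` -/

section ProjDerivation

open PathAlgebra

theorem sigma_eq_of_arrow_eq {V : Type*} [Quiver V] {a b a' b' : V} {e : a ⟶ b} {e' : a' ⟶ b'}
    (h : arrow e = arrow e') : (⟨a, b, e⟩ : Σ a b : V, a ⟶ b) = ⟨a', b', e'⟩ := by
  have h' : QPath.ofArrow e = QPath.ofArrow e' := congrArg Subtype.val h
  obtain ⟨rfl, h2⟩ := QPath.mk.inj h'
  obtain ⟨rfl, h3⟩ := h2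
  cases eq_of_heq h3
  rfl

theorem exists_eq_arrow {V : Type*} [Quiver V] (α : pathsOfLength V 1) :
    ∃ (a b : V) (e : a ⟶ b), α = arrow e := by
  obtain ⟨⟨a, b, p⟩, hp⟩ := α
  match p, hp with
  | Quiver.Path.cons Quiver.Path.nil e, _ => exact ⟨_, _, e, rfl⟩

variable {k : Type*} [Field k] {V : Type*} [Quiver V] [Fintype V]
variable {I : Ideal (PathAlgebra k V)} [I.IsTwoSided]

/-- A linear map `kQ → A` is a derivation over the projection `π : kQ → A` if it satisfies the
Leibniz rule, where `kQ` acts on `A` via `π`. -/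
def IsProjDerivation (d : PathAlgebra k V →ₗ[k] PathAlgebra k V ⧸ I) : Prop :=
  ∀ f g, d (f * g) = proj I f * d g + d f * proj I g

/-- A derivation `kQ → A` is determined by its values on the vertices and the arrows. -/
theorem IsProjDerivation.ext {d d' : PathAlgebra k V →ₗ[k] PathAlgebra k V ⧸ I}
    (hd : IsProjDerivation d) (hd' : IsProjDerivation d')
    (h0 : ∀ v, d (of (QPath.nil v)) = d' (of (QPath.nil v)))
    (h1 : ∀ (a b : V) (e : a ⟶ b), d (of (QPath.ofArrow e)) = d' (of (QPath.ofArrow e))) :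
    d = d' := by
  refine lhom_ext ?_
  rintro ⟨a, b, p⟩
  induction p with
  | nil => exact h0 a
  | cons p e ih => rw [of_cons, hd, hd', ih, h1]

theorem IsProjDerivation.comp_proj
    {D : (PathAlgebra k V ⧸ I) →ₗ[k] (PathAlgebra k V ⧸ I)}
    (hD : ∀ x y, D (x * y) = x * D y + D x * y) :
    IsProjDerivation (D ∘ₗ (proj I).toLinearMap) := by
  intro f g
  change D (proj I (f * g)) = _
  rw [map_mul, hD]
  rfl

/-- If a derivation vanishes on the vertices, then its value at an arrow `α` lies in
`t(α) A s(α)`. -/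
theorem IsProjDerivation.corner_ofArrow {d : PathAlgebra k V →ₗ[k] PathAlgebra k V ⧸ I}
    (hd : IsProjDerivation d) (h0 : ∀ v, d (of (QPath.nil v)) = 0) {a b : V} (e : a ⟶ b) :
    proj I (of (QPath.nil b)) * d (of (QPath.ofArrow e)) * proj I (of (QPath.nil a)) =
      d (of (QPath.ofArrow e)) := by
  have h1 : (of (QPath.nil b) * of (QPath.ofArrow e) * of (QPath.nil a) : PathAlgebra k V) =
      of (QPath.ofArrow e) := (corner_of _ _ _).trans (if_pos ⟨rfl, rfl⟩)
  conv_rhs => rw [← h1, hd, hd, h0, h0, mul_zero, zero_mul, zero_add, add_zero]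

variable [LinearOrder (QPath V)]

variable (I) in
/-- For `x ∈ k(Q_1 // ℬ)` the derivation `kQ → A` that sends a path `p` to
`∑ c_(α,γ) π(p^(α,γ))`. -/
def pairDerivation : PairSpace k (pathsOfLength V 1) (basisPaths I) →ₗ[k]
    (PathAlgebra k V →ₗ[k] PathAlgebra k V ⧸ I) :=
  PairSpace.extend fun z => (proj I).toLinearMap ∘ₗ replaceLin k z.1.1.1 z.1.2.1

theorem pairDerivation_of (z : ParallelPairs (pathsOfLength V 1) (basisPaths I))
    (f : PathAlgebra k V) :
    pairDerivation I (PairSpace.of z) f = proj I (replaceLin k z.1.1.1 z.1.2.1 f) := by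
  rw [pairDerivation, PairSpace.extend_of]
  rfl

theorem isProjDerivation_pairDerivation
    (x : PairSpace k (pathsOfLength V 1) (basisPaths I)) :
    IsProjDerivation (pairDerivation I x) := by
  intro f g
  have key : (pairDerivation I).flip (f * g) =
      LinearMap.mulLeft k (proj I f) ∘ₗ (pairDerivation I).flip g +
        LinearMap.mulRight k (proj I g) ∘ₗ (pairDerivation I).flip f := by
    refine PairSpace.lhom_ext fun z => ?_
    simp only [LinearMap.flip_apply, LinearMap.add_apply, LinearMap.comp_apply,
      LinearMap.mulLeft_apply, LinearMap.mulRight_apply, pairDerivation_of]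
    rw [replaceLin_mul z.2, map_add, map_mul, map_mul]
  exact congrArg (fun F => F x) key

theorem pairDerivation_nil (x : PairSpace k (pathsOfLength V 1) (basisPaths I)) (v : V) :
    pairDerivation I x (of (QPath.nil v)) = 0 := by
  have key : (pairDerivation I).flip (of (QPath.nil v)) = 0 := by
    refine PairSpace.lhom_ext fun z => ?_
    rw [LinearMap.flip_apply, pairDerivation_of, replaceLin_of, replace_nil, map_zero]
    rfl
  exact congrArg (fun F => F x) key

theorem pairDerivation_ofArrow (x : PairSpace k (pathsOfLength V 1) (basisPaths I)) {a b : V}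
    (e : a ⟶ b) : pairDerivation I x (of (QPath.ofArrow e)) = component I (arrow e) x := by
  have key : (pairDerivation I).flip (of (QPath.ofArrow e)) = component I (arrow e) := by
    refine PairSpace.lhom_ext fun z => ?_
    rw [LinearMap.flip_apply, pairDerivation_of, replaceLin_of, replace_ofArrow z.2,
      component_of]
    by_cases h : z.1.1 = arrow e
    · have h' : QPath.ofArrow e = z.1.1.1 := (congrArg Subtype.val h).symm
      rw [if_pos h, if_pos h']
    · rw [if_neg h, if_neg fun h' => h (Subtype.ext h'.symm), map_zero]
  exact congrArg (fun F => F x) key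

theorem pairDerivation_injective (wf : WellFounded fun p q : QPath V => p < q) :
    Function.Injective (pairDerivation I) := by
  intro x y h
  refine component_ext wf I fun α => ?_
  obtain ⟨a, b, e, rfl⟩ := exists_eq_arrow α
  rw [← pairDerivation_ofArrow, ← pairDerivation_ofArrow, h]

/-- Every derivation `kQ → A` that vanishes on the vertices comes from `k(Q_1 // ℬ)`. -/
theorem exists_pairDerivation_eq [∀ a b : V, Fintype (a ⟶ b)]
    (wf : WellFounded fun p q : QPath V => p < q)
    {d : PathAlgebra k V →ₗ[k] PathAlgebra k V ⧸ I} (hd : IsProjDerivation d)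
    (h0 : ∀ v, d (of (QPath.nil v)) = 0) : ∃ x, pairDerivation I x = d := by
  refine ⟨∑ s : Σ a b : V, a ⟶ b, pairWith wf I (arrow s.2.2) (d (of (QPath.ofArrow s.2.2))),
    (isProjDerivation_pairDerivation _).ext hd
      (fun v => (pairDerivation_nil _ v).trans (h0 v).symm) fun a b e => ?_⟩
  rw [pairDerivation_ofArrow, map_sum, Finset.sum_eq_single ⟨a, b, e⟩]
  · rw [component_pairWith, if_pos rfl]
    exact hd.corner_ofArrow h0 e
  · rintro ⟨a', b', e'⟩ _ hne
    rw [component_pairWith, if_neg]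
    exact fun h => hne (sigma_eq_of_arrow_eq h)
  · simp

end ProjDerivation

/-! ### Reduced Groebner bases -/

section Tip

open PathAlgebra

variable {k : Type*} [Field k] {V : Type*} [Quiver V] [LinearOrder (QPath V)]

theorem tip_mem_support {f : PathAlgebra k V} (hf : f ≠ 0) : tip f hf ∈ f.support :=
  Finset.max'_mem _ _

theorem le_tip {f : PathAlgebra k V} (hf : f ≠ 0) {p : QPath V} (hp : p ∈ f.support) :
    p ≤ tip f hf :=
  Finset.le_max' _ _ hp

theorem sub_tip_mem_span {f : PathAlgebra k V} (hf : f ≠ 0) :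
    f - coeff f (tip f hf) • of (tip f hf) ∈
      Submodule.span k (of (k := k) '' {p | p ∈ f.support ∧ p < tip f hf}) := by
  have h := Finset.add_sum_erase f.support (fun p => coeff f p • (of p : PathAlgebra k V))
    (tip_mem_support hf)
  rw [← eq_sum_support f] at h
  rw [sub_eq_of_eq_add' h.symm]
  refine Submodule.sum_mem _ fun p hp => Submodule.smul_mem _ _ (Submodule.subset_span ⟨p, ?_, rfl⟩)
  have hp' := Finset.mem_of_mem_erase hp
  exact ⟨hp', lt_of_le_of_ne (le_tip hf hp') (Finset.ne_of_mem_erase hp)⟩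

end Tip

section GroebnerBasis

open PathAlgebra

variable {k : Type*} [Field k] {V : Type*} [Quiver V] [Fintype V]

/-- The span of the paths that have a factor in `S` is closed under multiplication on both
sides. -/
theorem mul_mem_span_divides {S : Set (QPath V)} {f g : PathAlgebra k V}
    (h : f ∈ Submodule.span k (of (k := k) '' {p | ∃ s ∈ S, s.Divides p})) :
    g * f ∈ Submodule.span k (of (k := k) '' {p | ∃ s ∈ S, s.Divides p}) ∧
      f * g ∈ Submodule.span k (of (k := k) '' {p | ∃ s ∈ S, s.Divides p}) := by
  set M := Submodule.span k (of (k := k) '' {p : QPath V | ∃ s ∈ S, s.Divides p}) with hM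
  induction h using Submodule.span_induction with
  | zero => simp
  | add x y _ _ hx hy =>
    rw [mul_add, add_mul]
    exact ⟨M.add_mem hx.1 hy.1, M.add_mem hx.2 hy.2⟩
  | smul c x _ hx =>
    rw [mul_smul_comm, smul_mul_assoc]
    exact ⟨M.smul_mem c hx.1, M.smul_mem c hx.2⟩
  | mem x hx =>
    obtain ⟨_, ⟨s, hs, a, b, v, u, rfl⟩, rfl⟩ := hx
    rw [eq_sum_support g, Finset.sum_mul, Finset.mul_sum]
    refine ⟨M.sum_mem fun q _ => ?_, M.sum_mem fun q _ => ?_⟩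
    · rw [smul_mul_assoc]
      refine M.smul_mem _ ?_
      obtain ⟨c, d, q⟩ := q
      by_cases hc : b = c
      · subst hc
        rw [of_mk_mul_of_mk]
        exact Submodule.subset_span ⟨_, ⟨s, hs, a, d, v, u.comp q, by
          rw [Quiver.Path.comp_assoc]⟩, rfl⟩
      · rw [of_mul_of_eq_zero hc]
        exact M.zero_mem
    · rw [mul_smul_comm]
      refine M.smul_mem _ ?_
      obtain ⟨c, d, q⟩ := q
      by_cases hc : d = a
      · subst hc
        rw [of_mk_mul_of_mk]
        exact Submodule.subset_span ⟨_, ⟨s, hs, c, b, q.comp v, u, by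
          rw [Quiver.Path.comp_assoc, Quiver.Path.comp_assoc, Quiver.Path.comp_assoc]⟩, rfl⟩
      · rw [of_mul_of_eq_zero hc]
        exact M.zero_mem

/-- A path that lies in the two-sided ideal generated by a set of paths is divisible by one of
them. -/
theorem exists_divides_of_mem_span {S : Set (QPath V)} {p : QPath V}
    (h : (of p : PathAlgebra k V) ∈ TwoSidedIdeal.span (of (k := k) '' S)) :
    ∃ s ∈ S, s.Divides p := by
  set M := Submodule.span k (of (k := k) '' {p : QPath V | ∃ s ∈ S, s.Divides p}) with hM
  let J : TwoSidedIdeal (PathAlgebra k V) := TwoSidedIdeal.mk' (M : Set (PathAlgebra k V))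
    M.zero_mem (fun hx hy => M.add_mem hx hy) (fun hx => M.neg_mem hx)
    (fun hx => (mul_mem_span_divides hx).1) (fun hx => (mul_mem_span_divides hx).2)
  have hJ : TwoSidedIdeal.span (of (k := k) '' S) ≤ J := by
    rw [TwoSidedIdeal.span_le]
    rintro _ ⟨s, hs, rfl⟩
    refine (TwoSidedIdeal.mem_mk' ..).mpr (Submodule.subset_span ⟨s, ⟨s, hs, _, _,
      Quiver.Path.nil, Quiver.Path.nil, ?_⟩, rfl⟩)
    rw [Quiver.Path.nil_comp]
    rfl
  have hp : (of p : PathAlgebra k V) ∈ M := (TwoSidedIdeal.mem_mk' ..).mp (hJ h)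
  refine mem_span_of_iff.mp hp p ?_
  rw [support, coeff_of]
  simp

variable [LinearOrder (QPath V)]

variable {I : Ideal (PathAlgebra k V)}

theorem eq_zero_of_mem_span_nonTip {f : PathAlgebra k V} (hf : f ∈ I)
    (h : f ∈ Submodule.span k (of (k := k) '' nonTip (I : Set (PathAlgebra k V)))) : f = 0 := by
  by_contra hf0
  exact mem_span_of_iff.mp h _ (tip_mem_support hf0) ⟨f, hf, hf0, rfl⟩

namespace IsReducedGroebnerBasis

variable {𝒢 : Finset (PathAlgebra k V)} (h𝒢 : IsReducedGroebnerBasis I 𝒢)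
include h𝒢

/-- The elements of a reduced Groebner basis are uniform: with `t` and `s` the end points of the
tip of `g`, the element `g - t g s` of `I` is a combination of non-tips, hence zero. -/
theorem corner_eq [I.IsTwoSided] {g : PathAlgebra k V} (hg : g ∈ 𝒢) :
    of (QPath.nil (tip g (h𝒢.ne_zero g hg)).tgt) * g *
      of (QPath.nil (tip g (h𝒢.ne_zero g hg)).src) = g := by
  set t := tip g (h𝒢.ne_zero g hg) with ht
  have hgI := h𝒢.subset g hg
  symm
  rw [← sub_eq_zero]
  refine eq_zero_of_mem_span_nonTip (I := I)
    (I.sub_mem hgI (I.mul_mem_right _ (I.mul_mem_left _ hgI))) ?_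
  have hr := h𝒢.tail_mem g hg
  rw [← ht] at hr
  have htt : (of (QPath.nil t.tgt) * of t * of (QPath.nil t.src) : PathAlgebra k V) = of t := by
    rw [corner_of_parallel, if_pos ⟨rfl, rfl⟩]
  have h1 : g - of (QPath.nil t.tgt) * g * of (QPath.nil t.src) =
      (g - of t) - of (QPath.nil t.tgt) * (g - of t) * of (QPath.nil t.src) := by
    rw [mul_sub, sub_mul, htt]
    abel
  rw [h1]
  refine Submodule.sub_mem _ hr ?_
  generalize g - of t = r at hr
  induction hr using Submodule.span_induction with
  | zero => simp
  | add x y _ _ hx hy =>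
    rw [mul_add, add_mul]
    exact Submodule.add_mem _ hx hy
  | smul c x _ hx =>
    rw [mul_smul_comm, smul_mul_assoc]
    exact Submodule.smul_mem _ _ hx
  | mem x hx =>
    obtain ⟨p, hp, rfl⟩ := hx
    rw [corner_of_parallel]
    split_ifs
    · exact Submodule.subset_span ⟨p, hp, rfl⟩
    · exact Submodule.zero_mem _

theorem parallel_of_mem_support [I.IsTwoSided] {g : PathAlgebra k V} (hg : g ∈ 𝒢) {p : QPath V}
    (hp : p ∈ g.support) : (tip g (h𝒢.ne_zero g hg)).Parallel p := by
  have h : g ∈ Submodule.span k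
      (of (k := k) '' {p | (tip g (h𝒢.ne_zero g hg)).Parallel p}) := by
    have hc := h𝒢.corner_eq hg
    generalize tip g (h𝒢.ne_zero g hg) = t at hc
    rw [← hc]
    clear hc
    rw [eq_sum_support g, Finset.mul_sum, Finset.sum_mul]
    refine Submodule.sum_mem _ fun q _ => ?_
    rw [mul_smul_comm, smul_mul_assoc]
    refine Submodule.smul_mem _ _ ?_
    rw [corner_of_parallel]
    split_ifs with hq
    · exact Submodule.subset_span ⟨q, hq, rfl⟩
    · exact Submodule.zero_mem _
  exact mem_span_of_iff.mp h p hp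

theorem tip_injective {g h : PathAlgebra k V} (hg : g ∈ 𝒢) (hh : h ∈ 𝒢)
    (ht : tip g (h𝒢.ne_zero g hg) = tip h (h𝒢.ne_zero h hh)) : g = h := by
  by_contra hne
  refine h𝒢.tip_reduced g hg h hh hne ?_
  rw [ht]
  refine ⟨_, _, Quiver.Path.nil, Quiver.Path.nil, ?_⟩
  rw [Quiver.Path.nil_comp]
  rfl

theorem exists_tip_divides {f : PathAlgebra k V} (hf : f ∈ I) (hf0 : f ≠ 0) :
    ∃ (g : PathAlgebra k V) (hg : g ∈ 𝒢), (tip g (h𝒢.ne_zero g hg)).Divides (tip f hf0) := by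
  have h : (of (tip f hf0) : PathAlgebra k V) ∈
      TwoSidedIdeal.span (of (k := k) '' tipSet (I : Set (PathAlgebra k V))) :=
    TwoSidedIdeal.subset_span ⟨_, ⟨f, hf, hf0, rfl⟩, rfl⟩
  rw [h𝒢.span_tip] at h
  obtain ⟨_, ⟨g, hg, _, rfl⟩, hd⟩ := exists_divides_of_mem_span h
  exact ⟨g, hg, hd⟩

/-- A reduced Groebner basis generates the ideal: a subspace that contains all the multiples
`u g v` of its elements contains `I`. The proof is the division algorithm: subtracting a suitable
multiple `c u g v` lowers the tip. -/
theorem le_of_mul_mem [I.IsTwoSided] (hord : IsAdmissibleOrder V)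
    (K : Submodule k (PathAlgebra k V))
    (hK : ∀ g ∈ 𝒢, ∀ u v : PathAlgebra k V, u * g * v ∈ K) {f : PathAlgebra k V} (hf : f ∈ I) :
    f ∈ K := by
  suffices H : ∀ t : QPath V, ∀ f ∈ I, ∀ hf0 : f ≠ 0, tip f hf0 = t → f ∈ K by
    by_cases hf0 : f = 0
    · rw [hf0]
      exact K.zero_mem
    · exact H _ f hf hf0 rfl
  intro t
  induction t using hord.wf.induction with
  | _ t ih =>
    intro f hf hf0 ht
    obtain ⟨g, hg, a, b, v, u, hd⟩ := h𝒢.exists_tip_divides hf hf0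
    have g0 : g ≠ 0 := h𝒢.ne_zero g hg
    rw [ht] at hd
    set c := coeff f t with hc
    set m : PathAlgebra k V := of ⟨_, b, u⟩ * g * of ⟨a, _, v⟩ with hm
    have hmI : m ∈ I := I.mul_mem_right _ (I.mul_mem_left _ (h𝒢.subset g hg))
    have hmK : m ∈ K := hK g hg _ _
    have h1 : f - c • of t ∈ Submodule.span k (of (k := k) '' {q | q < t}) := by
      have := sub_tip_mem_span hf0
      rw [ht] at this
      exact Submodule.span_mono (Set.image_mono fun q hq => hq.2) this
    -- `m = u g v` is monic with tip `t`, since `g` is uniform and the order is admissible.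
    have h2 : m - of t ∈ Submodule.span k (of (k := k) '' {q | q < t}) := by
      have h3 := sub_tip_mem_span g0
      rw [h𝒢.monic g hg, one_smul] at h3
      have h4 : m - of t = of ⟨_, b, u⟩ * (g - of (tip g g0)) * of ⟨a, _, v⟩ := by
        rw [mul_sub, sub_mul, hm, hd, mul_assoc (of _) (of (tip g g0)), ← of_mk_mul_of_mk,
          ← of_mk_mul_of_mk]
      rw [h4]
      generalize g - of (tip g g0) = r at h3
      induction h3 using Submodule.span_induction with
      | zero => simp
      | add x y _ _ hx hy =>
        rw [mul_add, add_mul]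
        exact Submodule.add_mem _ hx hy
      | smul c x _ hx =>
        rw [mul_smul_comm, smul_mul_assoc]
        exact Submodule.smul_mem _ _ hx
      | mem x hx =>
        obtain ⟨q, ⟨hq, hlt⟩, rfl⟩ := hx
        have hpar := h𝒢.parallel_of_mem_support hg hq
        clear_value m
        obtain ⟨qs, qt, q⟩ := q
        generalize tip g g0 = w at *
        obtain ⟨ws, wt, w⟩ := w
        obtain ⟨h5, h6⟩ := hpar
        dsimp only at h5 h6
        subst h5 h6
        rw [of_mk_mul_of_mk, of_mk_mul_of_mk, hd]
        refine Submodule.subset_span ⟨_, ?_, rfl⟩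
        have := hord.mul_left _ _ u (hord.mul_right _ _ v hlt)
        rwa [Quiver.Path.comp_assoc] at this
    have h5 : f - c • m ∈ Submodule.span k (of (k := k) '' {q | q < t}) := by
      have := Submodule.sub_mem _ h1 (Submodule.smul_mem _ c h2)
      rwa [smul_sub, sub_sub_sub_cancel_right] at this
    have h6 : f - c • m ∈ K := by
      by_cases h0 : f - c • m = 0
      · rw [h0]
        exact K.zero_mem
      · refine ih (tip _ h0) (mem_span_of_iff.mp h5 _ (tip_mem_support h0)) _
          (I.sub_mem hf ?_) h0 rfl
        rw [← smul_one_mul]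
        exact I.mul_mem_left _ hmI
    have := K.add_mem h6 (K.smul_mem c hmK)
    rwa [sub_add_cancel] at this

end IsReducedGroebnerBasis

end GroebnerBasis

/-! ### The maps `ψ₀` and `ψ₁` in terms of derivations -/

section Psi

open PathAlgebra

theorem tgt_eq_src_of_length_zero {V : Type*} [Quiver V] (e : pathsOfLength V 0) :
    e.1.tgt = e.1.src := by
  obtain ⟨⟨a, b, p⟩, hp⟩ := e
  exact (Quiver.Path.eq_of_length_zero p hp).symm

variable {k : Type*} [Field k] {V : Type*} [Quiver V] [Fintype V] [LinearOrder (QPath V)]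
variable (wf : WellFounded fun p q : QPath V => p < q)
variable {I : Ideal (PathAlgebra k V)} [I.IsTwoSided]

/-- The component of `ψ₁ x` at the tip of `g` is the value at `g` of the derivation attached
to `x`. -/
theorem component_psiOne {𝒢 : Finset (PathAlgebra k V)} (h𝒢 : IsReducedGroebnerBasis I 𝒢)
    (x : PairSpace k (pathsOfLength V 1) (basisPaths I)) (g : 𝒢) :
    component I (groebnerTip h𝒢 g) (psiOne wf I h𝒢 x) = pairDerivation I x g.1 := by
  have key : component I (groebnerTip h𝒢 g) ∘ₗ psiOne wf I h𝒢 =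
      LinearMap.mulRight k (proj I (of (QPath.nil (groebnerTip h𝒢 g).1.src))) ∘ₗ
        LinearMap.mulLeft k (proj I (of (QPath.nil (groebnerTip h𝒢 g).1.tgt))) ∘ₗ
          (pairDerivation I).flip g.1 := by
    refine PairSpace.lhom_ext fun z => ?_
    rw [LinearMap.comp_apply, psiOne, PairSpace.extend_of, map_sum, Finset.sum_eq_single g]
    · simp only [LinearMap.comp_apply, LinearMap.flip_apply, pairDerivation_of]
      conv_rhs => rw [eq_sum_support g.1]
      simp only [map_sum, map_smul, component_pairWith, if_true, replaceLin_of]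
      rfl
    · intro g' _ hne
      rw [map_sum]
      refine Finset.sum_eq_zero fun p _ => ?_
      rw [map_smul, component_pairWith, if_neg, smul_zero]
      intro h
      exact hne (Subtype.ext (h𝒢.tip_injective g'.2 g.2 (congrArg Subtype.val h)))
    · simp
  have h := congrArg (fun F => F x) key
  refine h.trans ?_
  change proj I (of (QPath.nil (tip g.1 (h𝒢.ne_zero g.1 g.2)).tgt)) * pairDerivation I x g.1 *
    proj I (of (QPath.nil (tip g.1 (h𝒢.ne_zero g.1 g.2)).src)) = _
  have hd := isProjDerivation_pairDerivation x
  have hc := h𝒢.corner_eq g.2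
  generalize tip g.1 (h𝒢.ne_zero g.1 g.2) = t at hc ⊢
  conv_rhs => rw [← hc, hd, hd, pairDerivation_nil, pairDerivation_nil, mul_zero, zero_mul,
    zero_add, add_zero]

/-- The kernel of `ψ₁` consists of the `x` whose derivation `kQ → A` factors through `A`. -/
theorem mem_ker_psiOne_iff (hord : IsAdmissibleOrder V) {𝒢 : Finset (PathAlgebra k V)}
    (h𝒢 : IsReducedGroebnerBasis I 𝒢)
    (x : PairSpace k (pathsOfLength V 1) (basisPaths I)) :
    x ∈ LinearMap.ker (psiOne hord.wf I h𝒢) ↔ ∀ f ∈ I, pairDerivation I x f = 0 := by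
  rw [LinearMap.mem_ker]
  constructor
  · intro hx f hf
    have hg0 : ∀ g ∈ 𝒢, pairDerivation I x g = 0 := fun g hg => by
      rw [← component_psiOne hord.wf h𝒢 x ⟨g, hg⟩, hx, map_zero]
    refine h𝒢.le_of_mul_mem hord (LinearMap.ker (pairDerivation I x)) (fun g hg u v => ?_) hf
    have hd := isProjDerivation_pairDerivation x
    have hπ : proj I g = 0 := Ideal.Quotient.eq_zero_iff_mem.mpr (h𝒢.subset g hg)
    rw [LinearMap.mem_ker, hd, hd, hg0 g hg, map_mul, hπ]
    simp
  · intro hx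
    refine component_ext hord.wf I ?_
    rintro ⟨_, g, hg, _, rfl⟩
    rw [map_zero]
    exact (component_psiOne hord.wf h𝒢 x ⟨g, hg⟩).trans (hx g (h𝒢.subset g hg))

variable (I) in
/-- The linear map `k(Q_0 // ℬ) → A`, `(e, γ) ↦ π(γ)`. -/
def loopValue : PairSpace k (pathsOfLength V 0) (basisPaths I) →ₗ[k] PathAlgebra k V ⧸ I :=
  PairSpace.extend fun z => proj I (of z.1.2.1)

theorem loopValue_of (z : ParallelPairs (pathsOfLength V 0) (basisPaths I)) :
    loopValue I (PairSpace.of z) = proj I (of z.1.2.1) :=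
  PairSpace.extend_of _ z

include wf in
/-- The elements of `A` that commute with all vertices come from `k(Q_0 // ℬ)`. -/
theorem exists_loopValue_eq {a : PathAlgebra k V ⧸ I}
    (ha : ∀ v, proj I (of (QPath.nil v)) * a = a * proj I (of (QPath.nil v))) :
    ∃ w, loopValue I w = a := by
  let vertex : V → pathsOfLength V 0 := fun v => ⟨QPath.nil v, rfl⟩
  have key : ∀ (v : V) (a : PathAlgebra k V ⧸ I), loopValue I (pairWith wf I (vertex v) a) =
      proj I (of (QPath.nil v)) * a * proj I (of (QPath.nil v)) := by
    intro v a
    have h : loopValue I ∘ₗ pairWith wf I (vertex v) =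
        LinearMap.mulRight k (proj I (of (QPath.nil v))) ∘ₗ
          LinearMap.mulLeft k (proj I (of (QPath.nil v))) := by
      refine (nonTipBasis I wf).ext fun b => ?_
      rw [nonTipBasis_apply, LinearMap.comp_apply, pairWith_proj_of, LinearMap.comp_apply,
        LinearMap.mulLeft_apply, LinearMap.mulRight_apply, ← map_mul, ← map_mul]
      refine Eq.trans ?_ (congrArg (proj I) (corner_of_parallel (QPath.nil v) b.1)).symm
      split_ifs with hp
      · exact loopValue_of _
      · rw [map_zero, map_zero]
    exact congrArg (fun F => F a) h
  refine ⟨∑ v, pairWith wf I (vertex v) a, ?_⟩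
  have hsq : ∀ v, proj I (of (QPath.nil v)) * a * proj I (of (QPath.nil v)) =
      proj I (of (QPath.nil v)) * a := fun v => by
    rw [mul_assoc, ← ha, ← mul_assoc, ← map_mul, of_nil_mul_of,
      if_pos (show (QPath.nil v).tgt = v from rfl)]
  rw [map_sum]
  simp only [key, hsq]
  rw [← Finset.sum_mul, ← map_sum, ← one_def, map_one, one_mul]

variable [∀ a b : V, Fintype (a ⟶ b)]

/-- The derivation attached to `ψ₀ w` is inner. -/
theorem pairDerivation_psiZero (w : PairSpace k (pathsOfLength V 0) (basisPaths I))
    (f : PathAlgebra k V) :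
    pairDerivation I (psiZero wf I w) f =
      proj I f * loopValue I w - loopValue I w * proj I f := by
  have key : pairDerivation I ∘ₗ psiZero wf I =
      ((LinearMap.mul k (PathAlgebra k V ⧸ I)).compl₁₂ (proj I).toLinearMap (loopValue I)).flip -
        (LinearMap.mul k (PathAlgebra k V ⧸ I)).compl₁₂ (loopValue I) (proj I).toLinearMap := by
    refine PairSpace.lhom_ext fun z => ?_
    refine (isProjDerivation_pairDerivation _).ext ?_ ?_ ?_
    · intro f g
      simp only [LinearMap.sub_apply, LinearMap.flip_apply, LinearMap.compl₁₂_apply,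
        LinearMap.mul_apply', AlgHom.toLinearMap_apply, map_mul]
      noncomm_ring
    · intro v
      change pairDerivation I (psiZero wf I (PairSpace.of z)) _ = _
      rw [pairDerivation_nil]
      simp only [LinearMap.sub_apply, LinearMap.flip_apply, LinearMap.compl₁₂_apply,
        LinearMap.mul_apply', AlgHom.toLinearMap_apply, loopValue_of, ← map_mul]
      have hz : z.1.2.1.tgt = z.1.2.1.src :=
        z.2.2.symm.trans ((tgt_eq_src_of_length_zero z.1.1).trans z.2.1)
      rw [of_nil_mul_of, of_mul_of_nil, hz, sub_self]
    · intro a b e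
      change pairDerivation I (psiZero wf I (PairSpace.of z)) _ = _
      rw [pairDerivation_ofArrow, psiZero, PairSpace.extend_of, map_sub]
      simp only [LinearMap.sub_apply, LinearMap.flip_apply, LinearMap.compl₁₂_apply,
        LinearMap.mul_apply', AlgHom.toLinearMap_apply, loopValue_of, map_sum,
        component_pairWith]
      have hs : z.1.2.1.src = z.1.1.1.src := z.2.1.symm
      have ht : z.1.2.1.tgt = z.1.1.1.src :=
        z.2.2.symm.trans (tgt_eq_src_of_length_zero z.1.1)
      generalize z.1.1.1.src = s at hs ht ⊢
      generalize z.1.2.1 = γ at hs ht ⊢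
      obtain ⟨γs, γt, γ⟩ := γ
      dsimp only at hs ht
      subst hs ht
      congr 1
      · by_cases ha : γt = a
        · subst ha
          rw [Finset.sum_eq_single b, Finset.sum_eq_single e, if_pos rfl, ← map_mul, ← map_mul,
            ← map_mul]
          · congr 1
            exact (congrArg (fun f => of (QPath.nil b) * f * of (QPath.nil γt))
              (of_mk_mul_of_mk _ _)).trans (((corner_of _ _ _).trans
                (if_pos ⟨rfl, rfl⟩)).trans (of_mk_mul_of_mk _ _).symm)
          · intro α _ hne
            rw [if_neg]
            intro h
            cases sigma_eq_of_arrow_eq h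
            exact hne rfl
          · simp
          · intro c _ hne
            refine Finset.sum_eq_zero fun α _ => if_neg fun h => ?_
            cases sigma_eq_of_arrow_eq h
            exact hne rfl
          · simp
        · rw [← map_mul, of_mul_of_eq_zero ha, map_zero]
          refine Finset.sum_eq_zero fun c _ => Finset.sum_eq_zero fun α _ => if_neg fun h => ?_
          cases sigma_eq_of_arrow_eq h
          exact ha rfl
      · by_cases hb : b = γt
        · subst hb
          rw [Finset.sum_eq_single a, Finset.sum_eq_single e, if_pos rfl, ← map_mul, ← map_mul,
            ← map_mul]
          · congr 1
            exact (congrArg (fun f => of (QPath.nil b) * f * of (QPath.nil a))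
              (of_mk_mul_of_mk _ _)).trans (((corner_of _ _ _).trans
                (if_pos ⟨rfl, rfl⟩)).trans (of_mk_mul_of_mk _ _).symm)
          · intro α _ hne
            rw [if_neg]
            intro h
            cases sigma_eq_of_arrow_eq h
            exact hne rfl
          · simp
          · intro c _ hne
            refine Finset.sum_eq_zero fun α _ => if_neg fun h => ?_
            cases sigma_eq_of_arrow_eq h
            exact hne rfl
          · simp
        · rw [← map_mul, of_mul_of_eq_zero hb, map_zero]
          refine Finset.sum_eq_zero fun c _ => Finset.sum_eq_zero fun α _ => if_neg fun h => ?_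
          cases sigma_eq_of_arrow_eq h
          exact hb rfl
  exact congrArg (fun F => F w f) key

end Psi

/-! ### The derivation of `A` attached to an element of `Ker ψ₁` -/

section InducedDerivation

open PathAlgebra

variable {k : Type*} [Field k] {V : Type*} [Quiver V] [Fintype V] [LinearOrder (QPath V)]
variable (wf : WellFounded fun p q : QPath V => p < q)
variable (I : Ideal (PathAlgebra k V)) [I.IsTwoSided]

/-- The `k`-linear section `A → kQ` of `π` that sends the class of a non-tip to itself. -/
def projSection : (PathAlgebra k V ⧸ I) →ₗ[k] PathAlgebra k V :=
  (nonTipBasis I wf).constr k fun b => of b.1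

theorem proj_projSection (a : PathAlgebra k V ⧸ I) : proj I (projSection wf I a) = a := by
  have key : (proj I).toLinearMap ∘ₗ projSection wf I = LinearMap.id := by
    refine (nonTipBasis I wf).ext fun b => ?_
    rw [LinearMap.comp_apply, projSection, Module.Basis.constr_basis, nonTipBasis_apply]
    rfl
  exact congrArg (fun F => F a) key

/-- The endomorphism `D_x` of `A` attached to `x ∈ k(Q_1 // ℬ)`. It is a derivation for
`x ∈ Ker ψ₁`; for other `x` the value depends on
the choice of the section of `π`. -/
def inducedMap : PairSpace k (pathsOfLength V 1) (basisPaths I) →ₗ[k]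
    ((PathAlgebra k V ⧸ I) →ₗ[k] (PathAlgebra k V ⧸ I)) :=
  LinearMap.lcomp k _ (projSection wf I) ∘ₗ pairDerivation I

variable {I}

theorem inducedMap_proj {x : PairSpace k (pathsOfLength V 1) (basisPaths I)}
    (hx : ∀ f ∈ I, pairDerivation I x f = 0) (f : PathAlgebra k V) :
    inducedMap wf I x (proj I f) = pairDerivation I x f := by
  change pairDerivation I x (projSection wf I (proj I f)) = _
  rw [← sub_eq_zero, ← map_sub]
  refine hx _ (Ideal.Quotient.eq_zero_iff_mem.mp ?_)
  change proj I _ = 0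
  rw [map_sub, proj_projSection, sub_self]

theorem inducedMap_mul {x : PairSpace k (pathsOfLength V 1) (basisPaths I)}
    (hx : ∀ f ∈ I, pairDerivation I x f = 0) (a b : PathAlgebra k V ⧸ I) :
    inducedMap wf I x (a * b) = a * inducedMap wf I x b + inducedMap wf I x a * b := by
  obtain ⟨f, rfl⟩ := Ideal.Quotient.mkₐ_surjective k I a
  obtain ⟨g, rfl⟩ := Ideal.Quotient.mkₐ_surjective k I b
  rw [← map_mul, inducedMap_proj wf hx, inducedMap_proj wf hx, inducedMap_proj wf hx]
  exact isProjDerivation_pairDerivation x f g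

theorem inducedMap_mem_ker {x : PairSpace k (pathsOfLength V 1) (basisPaths I)}
    (hx : ∀ f ∈ I, pairDerivation I x f = 0) :
    inducedMap wf I x ∈ LinearMap.ker (hochschildDeltaOne k (PathAlgebra k V ⧸ I)) :=
  (mem_ker_hochschildDeltaOne k _ _).mpr (inducedMap_mul wf hx)

/-- The component at an arrow `e` of `[x, y]` is `δ_x(y_e) - δ_y(x_e)`, where `δ_x` is the
derivation `kQ → A` attached to `x`, and the components `x_e`, `y_e` are lifted to `kQ` as
combinations of non-tips. This holds for all `x` and `y`, inside `Ker ψ₁` or not. -/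
theorem component_parallelBracket (x y : PairSpace k (pathsOfLength V 1) (basisPaths I))
    {a b : V} (e : a ⟶ b) :
    component I (arrow e) (parallelBracket wf I x y) =
      pairDerivation I x (projSection wf I (component I (arrow e) y)) -
        pairDerivation I y (projSection wf I (component I (arrow e) x)) := by
  have hcorner : ∀ (z w : ParallelPairs (pathsOfLength V 1) (basisPaths I)),
      component I (arrow e) (pairWith wf I z.1.1
        (proj I (replace z.1.2.1 w.1.1.1 w.1.2.1))) =
      pairDerivation I (PairSpace.of w)
        (projSection wf I (component I (arrow e) (PairSpace.of z))) := by
    intro z w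
    rw [component_pairWith, component_of]
    split_ifs with h
    · have hs : projSection wf I (proj I (of z.1.2.1)) = of z.1.2.1 := by
        rw [← nonTipBasis_apply wf, projSection, Module.Basis.constr_basis]
      rw [hs, pairDerivation_of, replaceLin_of, ← map_mul, ← map_mul, z.2.1, z.2.2]
      refine congrArg (proj I) ?_
      rw [replace, of_nil_mul_replaceAux w.2, replaceAux_mul_of_nil]
    · rw [map_zero, map_zero]
  have key : (parallelBracket wf I).compr₂ (component I (arrow e)) =
      (LinearMap.compl₂ (pairDerivation I) (projSection wf I ∘ₗ component I (arrow e))) -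
        (LinearMap.compl₂ (pairDerivation I)
          (projSection wf I ∘ₗ component I (arrow e))).flip := by
    refine PairSpace.lhom_ext fun z => PairSpace.lhom_ext fun w => ?_
    simp only [LinearMap.compr₂_apply, LinearMap.sub_apply, LinearMap.flip_apply,
      LinearMap.compl₂_apply, LinearMap.comp_apply]
    rw [parallelBracket, PairSpace.extend_of, PairSpace.extend_of, map_sub, hcorner, hcorner]
  exact congrArg (fun F => F x y) key

/-- For `x, y ∈ Ker ψ₁` the derivation attached to `[x, y]` is the commutator of `D_x`
and `D_y`. -/
theorem pairDerivation_parallelBracket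
    {x y : PairSpace k (pathsOfLength V 1) (basisPaths I)}
    (hx : ∀ f ∈ I, pairDerivation I x f = 0) (hy : ∀ f ∈ I, pairDerivation I y f = 0) :
    pairDerivation I (parallelBracket wf I x y) =
      (inducedMap wf I x ∘ₗ inducedMap wf I y - inducedMap wf I y ∘ₗ inducedMap wf I x) ∘ₗ
        (proj I).toLinearMap := by
  refine (isProjDerivation_pairDerivation _).ext (IsProjDerivation.comp_proj fun a b => ?_)
    (fun v => ?_) fun a b e => ?_
  · simp only [LinearMap.sub_apply, LinearMap.comp_apply, inducedMap_mul wf hx,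
      inducedMap_mul wf hy, map_add]
    noncomm_ring
  · change _ = inducedMap wf I x (inducedMap wf I y (proj I _)) -
      inducedMap wf I y (inducedMap wf I x (proj I _))
    rw [inducedMap_proj wf hx, inducedMap_proj wf hy, pairDerivation_nil, pairDerivation_nil,
      pairDerivation_nil, map_zero, map_zero, sub_zero]
  · change _ = inducedMap wf I x (inducedMap wf I y (proj I _)) -
      inducedMap wf I y (inducedMap wf I x (proj I _))
    rw [inducedMap_proj wf hx, inducedMap_proj wf hy, pairDerivation_ofArrow,
      pairDerivation_ofArrow, pairDerivation_ofArrow, component_parallelBracket]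
    rfl

end InducedDerivation

section Vertices

open PathAlgebra

variable {k : Type*} [Field k] {V : Type*} [Quiver V] [Fintype V]
variable {I : Ideal (PathAlgebra k V)} [I.IsTwoSided]

/-- Up to an inner derivation, every derivation of `A` vanishes on the vertices: subtract the
commutator with `∑ D(e) e`, where `e` runs through the vertices. -/
theorem exists_inner_eq_on_vertices
    {D : (PathAlgebra k V ⧸ I) →ₗ[k] (PathAlgebra k V ⧸ I)}
    (hD : ∀ x y, D (x * y) = x * D y + D x * y) :
    ∃ a, ∀ v, D (proj I (of (QPath.nil v))) =
      a * proj I (of (QPath.nil v)) - proj I (of (QPath.nil v)) * a := by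
  set ε : V → PathAlgebra k V ⧸ I := fun v => proj I (of (QPath.nil v)) with hε
  have hmul : ∀ v w, ε v * ε w = if v = w then ε v else 0 := by
    intro v w
    rw [hε]
    dsimp only
    rw [← map_mul, of_mul_of_nil]
    change proj I (if v = w then _ else _) = _
    split_ifs
    · rfl
    · exact map_zero _
  have hone : ∑ v, ε v = 1 := by
    rw [hε, ← map_sum, ← one_def, map_one]
  refine ⟨∑ w, D (ε w) * ε w, fun v => ?_⟩
  change D (ε v) = (∑ w, D (ε w) * ε w) * ε v - ε v * ∑ w, D (ε w) * ε w
  have h1 : (∑ w, D (ε w) * ε w) * ε v = D (ε v) * ε v := by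
    rw [Finset.sum_mul, Finset.sum_eq_single v]
    · rw [mul_assoc, hmul, if_pos rfl]
    · intro w _ hw
      rw [mul_assoc, hmul, if_neg hw, mul_zero]
    · simp
  -- `ε v D(ε w) = D(ε v ε w) - D(ε v) ε w`
  have h2 : ∀ w, ε v * (D (ε w) * ε w) = (if v = w then D (ε v) * ε v else 0) - D (ε v) * ε w := by
    intro w
    have := congrArg (· * ε w) (hD (ε v) (ε w))
    simp only [add_mul, mul_assoc, hmul w w, if_true] at this
    rw [eq_sub_iff_add_eq, ← this, hmul]
    split_ifs with h
    · rw [h]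
    · rw [map_zero, zero_mul]
  rw [h1, Finset.mul_sum, Finset.sum_congr rfl fun w _ => h2 w, Finset.sum_sub_distrib,
    Finset.sum_ite_eq, ← Finset.mul_sum, hone, if_pos (Finset.mem_univ v), mul_one]
  abel

end Vertices

/-! ### The isomorphism with the first Hochschild cohomology -/

section Hochschild

variable (k : Type*) [Field k] (A : Type*) [Ring A] [Algebra k A]

/-- The projection from the 1-cocycles onto `HH¹(A)`. -/
def hochschildClass : LinearMap.ker (hochschildDeltaOne k A) →ₗ[k] HochschildOne k A where
  toFun f := HochschildOne.mk f.1 f.2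
  map_add' _ _ := rfl
  map_smul' _ _ := rfl

variable {k A}

theorem HochschildOne.mk_congr {f g : A →ₗ[k] A}
    (hf : f ∈ LinearMap.ker (hochschildDeltaOne k A))
    (hg : g ∈ LinearMap.ker (hochschildDeltaOne k A)) (h : f = g) :
    HochschildOne.mk f hf = HochschildOne.mk g hg := by
  subst h
  rfl

theorem HochschildOne.mk_eq_zero_iff {f : A →ₗ[k] A}
    (hf : f ∈ LinearMap.ker (hochschildDeltaOne k A)) :
    HochschildOne.mk f hf = 0 ↔ ∃ a, ∀ x, f x = a * x - x * a := by
  refine (LieSubmodule.Quotient.mk_eq_zero' (N := hochschildCoboundaries k A)).trans ?_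
  constructor
  · rintro ⟨a, ha⟩
    exact ⟨a, fun x => (congrArg (fun F => F x) ha).symm⟩
  · rintro ⟨a, ha⟩
    exact ⟨a, LinearMap.ext fun x => (ha x).symm⟩

theorem HochschildOne.exists_eq_mk (c : HochschildOne k A) :
    ∃ (f : A →ₗ[k] A) (hf : f ∈ LinearMap.ker (hochschildDeltaOne k A)),
      c = HochschildOne.mk f hf := by
  obtain ⟨⟨f, hf⟩, rfl⟩ := LieSubmodule.Quotient.surjective_mk' (hochschildCoboundaries k A) c
  exact ⟨f, hf, rfl⟩

end Hochschild

section Main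

open PathAlgebra

variable {k : Type*} [Field k] {V : Type*} [Quiver V] [Fintype V]
  [LinearOrder (QPath V)] (hord : IsAdmissibleOrder V)
  {I : Ideal (PathAlgebra k V)} [I.IsTwoSided]
  {𝒢 : Finset (PathAlgebra k V)} (h𝒢 : IsReducedGroebnerBasis I 𝒢)

theorem parallelBracket_mem_ker (x y : LinearMap.ker (psiOne hord.wf I h𝒢)) :
    parallelBracket hord.wf I x.1 y.1 ∈ LinearMap.ker (psiOne hord.wf I h𝒢) := by
  refine (mem_ker_psiOne_iff hord h𝒢 _).mpr fun f hf => ?_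
  have hπ : proj I f = 0 := Ideal.Quotient.eq_zero_iff_mem.mpr hf
  rw [pairDerivation_parallelBracket hord.wf ((mem_ker_psiOne_iff hord h𝒢 _).mp x.2)
    ((mem_ker_psiOne_iff hord h𝒢 _).mp y.2), LinearMap.comp_apply, AlgHom.toLinearMap_apply, hπ,
    map_zero]

/-- The map `Ker ψ₁ → HH¹(A)`, `x ↦ [D_x]`. -/
def kerToHochschildOne : LinearMap.ker (psiOne hord.wf I h𝒢) →ₗ[k]
    HochschildOne k (PathAlgebra k V ⧸ I) :=
  hochschildClass k _ ∘ₗ (inducedMap hord.wf I).restrict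
    fun _ hx => inducedMap_mem_ker hord.wf ((mem_ker_psiOne_iff hord h𝒢 _).mp hx)

theorem kerToHochschildOne_apply (x : LinearMap.ker (psiOne hord.wf I h𝒢)) :
    kerToHochschildOne hord h𝒢 x = HochschildOne.mk (inducedMap hord.wf I x.1)
      (inducedMap_mem_ker hord.wf ((mem_ker_psiOne_iff hord h𝒢 _).mp x.2)) := rfl

theorem kerToHochschildOne_parallelBracket (x y : LinearMap.ker (psiOne hord.wf I h𝒢)) :
    kerToHochschildOne hord h𝒢 ⟨_, parallelBracket_mem_ker hord h𝒢 x y⟩ =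
      ⁅kerToHochschildOne hord h𝒢 x, kerToHochschildOne hord h𝒢 y⁆ := by
  have hx := (mem_ker_psiOne_iff hord h𝒢 _).mp x.2
  have hy := (mem_ker_psiOne_iff hord h𝒢 _).mp y.2
  have hxy := (mem_ker_psiOne_iff hord h𝒢 _).mp (parallelBracket_mem_ker hord h𝒢 x y)
  obtain ⟨h, hlie⟩ := HochschildOne.lie_mk _ _ (inducedMap_mem_ker hord.wf hx)
    (inducedMap_mem_ker hord.wf hy)
  refine (HochschildOne.mk_congr _ h (LinearMap.ext fun a => ?_)).trans hlie.symm
  obtain ⟨f, rfl⟩ := Ideal.Quotient.mkₐ_surjective k I a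
  change inducedMap hord.wf I (parallelBracket hord.wf I x.1 y.1) (proj I f) = _
  rw [inducedMap_proj hord.wf hxy, pairDerivation_parallelBracket hord.wf hx hy]
  rfl

variable [∀ a b : V, Fintype (a ⟶ b)]

theorem range_psiZero_le_ker_psiOne :
    LinearMap.range (psiZero hord.wf I) ≤ LinearMap.ker (psiOne hord.wf I h𝒢) := by
  rintro _ ⟨w, rfl⟩
  refine (mem_ker_psiOne_iff hord h𝒢 _).mpr fun f hf => ?_
  have hπ : proj I f = 0 := Ideal.Quotient.eq_zero_iff_mem.mpr hf
  rw [pairDerivation_psiZero, hπ, zero_mul, mul_zero, sub_zero]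

theorem kerToHochschildOne_surjective :
    Function.Surjective (kerToHochschildOne hord h𝒢) := by
  intro c
  obtain ⟨D, hDker, rfl⟩ := HochschildOne.exists_eq_mk c
  have hD := (mem_ker_hochschildDeltaOne k _ D).mp hDker
  obtain ⟨a, ha⟩ := exists_inner_eq_on_vertices hD
  set D' := D - hochschildDeltaZero k (PathAlgebra k V ⧸ I) a with hD'
  have happ : ∀ x, D' x = D x - (a * x - x * a) := fun _ => rfl
  have hD'mul : ∀ x y, D' (x * y) = x * D' y + D' x * y := by
    intro x y
    rw [happ, happ, happ, hD]
    noncomm_ring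
  obtain ⟨x, hx⟩ := exists_pairDerivation_eq hord.wf (IsProjDerivation.comp_proj hD'mul)
    fun v => by
      change D' (proj I _) = 0
      rw [happ, ha, sub_self]
  have hxI : ∀ f ∈ I, pairDerivation I x f = 0 := fun f hf => by
    have hπ : proj I f = 0 := Ideal.Quotient.eq_zero_iff_mem.mpr hf
    rw [hx, LinearMap.comp_apply, AlgHom.toLinearMap_apply, hπ, map_zero]
  refine ⟨⟨x, (mem_ker_psiOne_iff hord h𝒢 x).mpr hxI⟩, ?_⟩
  rw [kerToHochschildOne_apply, ← sub_eq_zero]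
  refine (HochschildOne.mk_eq_zero_iff (Submodule.sub_mem _ (inducedMap_mem_ker hord.wf hxI)
    hDker)).mpr ⟨-a, fun b => ?_⟩
  obtain ⟨f, rfl⟩ := Ideal.Quotient.mkₐ_surjective k I b
  rw [LinearMap.sub_apply, inducedMap_proj hord.wf hxI, hx]
  change D' (proj I f) - _ = _
  rw [happ]
  noncomm_ring

theorem ker_kerToHochschildOne : LinearMap.ker (kerToHochschildOne hord h𝒢) =
    (LinearMap.range (psiZero hord.wf I)).submoduleOf (LinearMap.ker (psiOne hord.wf I h𝒢)) := by
  ext ⟨x, hx⟩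
  have hxI := (mem_ker_psiOne_iff hord h𝒢 _).mp hx
  rw [LinearMap.mem_ker, kerToHochschildOne_apply, HochschildOne.mk_eq_zero_iff,
    Submodule.submoduleOf, Submodule.mem_comap, LinearMap.mem_range]
  constructor
  · rintro ⟨a, ha⟩
    have hcomm : ∀ v, proj I (of (QPath.nil v)) * -a = -a * proj I (of (QPath.nil v)) := by
      intro v
      have h := ha (proj I (of (QPath.nil v)))
      rw [inducedMap_proj hord.wf hxI, pairDerivation_nil] at h
      rw [mul_neg, neg_mul, sub_eq_zero.mp h.symm]
    obtain ⟨w, hw⟩ := exists_loopValue_eq hord.wf hcomm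
    refine ⟨w, pairDerivation_injective hord.wf (LinearMap.ext fun f => ?_)⟩
    rw [pairDerivation_psiZero, hw]
    change _ = pairDerivation I x f
    rw [← inducedMap_proj hord.wf hxI, ha]
    noncomm_ring
  · rintro ⟨w, rfl⟩
    refine ⟨-loopValue I w, fun b => ?_⟩
    obtain ⟨f, rfl⟩ := Ideal.Quotient.mkₐ_surjective k I b
    change inducedMap hord.wf I (psiZero hord.wf I w) _ = _
    rw [inducedMap_proj hord.wf hxI]
    refine (pairDerivation_psiZero hord.wf w f).trans ?_
    noncomm_ring

end Main
end

theorem theorem3p6 {k : Type*} [Field k] {V : Type*} [Quiver V] [Fintype V]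
    [∀ a b : V, Fintype (a ⟶ b)] [LinearOrder (QPath V)] (hord : IsAdmissibleOrder V)
    (I : Ideal (PathAlgebra k V)) [I.IsTwoSided]
    (hI : ∀ f ∈ I, ∀ p ∈ f.support, 2 ≤ p.length)
    (𝒢 : Finset (PathAlgebra k V)) (h𝒢 : IsReducedGroebnerBasis I 𝒢) :
    LinearMap.range (psiZero hord.wf I) ≤ LinearMap.ker (psiOne hord.wf I h𝒢) ∧
    ∃ br : KerModIm hord.wf I h𝒢 →ₗ[k] KerModIm hord.wf I h𝒢 →ₗ[k] KerModIm hord.wf I h𝒢,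
      (∀ x y : LinearMap.ker (psiOne hord.wf I h𝒢),
        ∃ hxy : parallelBracket hord.wf I x.1 y.1 ∈ LinearMap.ker (psiOne hord.wf I h𝒢),
          br (Submodule.Quotient.mk x) (Submodule.Quotient.mk y) =
            Submodule.Quotient.mk ⟨parallelBracket hord.wf I x.1 y.1, hxy⟩) ∧
      IsLieBracket br ∧
      ∃ φ : KerModIm hord.wf I h𝒢 ≃ₗ[k] HochschildOne k (PathAlgebra k V ⧸ I),
        (∀ u v, φ (br u v) = ⁅φ u, φ v⁆) ∧
        ∀ x : LinearMap.ker (psiOne hord.wf I h𝒢),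
          ∃ (D : (PathAlgebra k V ⧸ I) →ₗ[k] (PathAlgebra k V ⧸ I))
            (hD : D ∈ LinearMap.ker (hochschildDeltaOne k (PathAlgebra k V ⧸ I))),
            (∀ v : V, D (proj I (PathAlgebra.of (QPath.nil v))) = 0) ∧
            (∀ (a b : V) (α : a ⟶ b),
              D (proj I (PathAlgebra.of (QPath.ofArrow α))) = valueAt x.1 (arrow α)) ∧
            φ (Submodule.Quotient.mk x) = HochschildOne.mk D hD := by
  -- The bracket on the quotient is transported from `HH¹(A)`.
  let φ : KerModIm hord.wf I h𝒢 ≃ₗ[k] HochschildOne k (PathAlgebra k V ⧸ I) :=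
    (Submodule.quotEquivOfEq _ _ (ker_kerToHochschildOne hord h𝒢).symm).trans
      ((kerToHochschildOne hord h𝒢).quotKerEquivOfSurjective
        (kerToHochschildOne_surjective hord h𝒢))
  have hφ : ∀ x, φ (Submodule.Quotient.mk x) = kerToHochschildOne hord h𝒢 x := fun _ => rfl
  let br : KerModIm hord.wf I h𝒢 →ₗ[k] KerModIm hord.wf I h𝒢 →ₗ[k] KerModIm hord.wf I h𝒢 :=
    LinearMap.mk₂ k (fun u v => φ.symm ⁅φ u, φ v⁆)
      (fun u v w => by rw [map_add, add_lie, map_add])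
      (fun c u v => by rw [map_smul, smul_lie, map_smul])
      (fun u v w => by rw [map_add, lie_add, map_add])
      (fun c u v => by rw [map_smul, lie_smul, map_smul])
  have hbr : ∀ u v, φ (br u v) = ⁅φ u, φ v⁆ := fun u v => φ.apply_symm_apply _
  refine ⟨range_psiZero_le_ker_psiOne hord h𝒢, br, fun x y => ?_, ⟨fun u => ?_, fun u v w => ?_⟩,
    φ, hbr, fun x => ?_⟩
  · refine ⟨parallelBracket_mem_ker hord h𝒢 x y, φ.injective ?_⟩
    rw [hbr, hφ, hφ, hφ, kerToHochschildOne_parallelBracket]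
  · apply φ.injective
    rw [hbr, lie_self, map_zero]
  · apply φ.injective
    rw [map_add, map_add, hbr, hbr, hbr, hbr, hbr, hbr, map_zero]
    exact lie_jacobi _ _ _
  · have hx := (mem_ker_psiOne_iff hord h𝒢 _).mp x.2
    refine ⟨inducedMap hord.wf I x.1, inducedMap_mem_ker hord.wf hx, fun v => ?_,
      fun a b α => ?_, rfl⟩
    · rw [inducedMap_proj hord.wf hx, pairDerivation_nil]
    · rw [inducedMap_proj hord.wf hx, pairDerivation_ofArrow]
      rfl
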